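/- Let $(t_k)_{k\ge 2}$ be the points, in increasing order, of a Poisson point process of rate $1$ on $[0,\infty)$, and let $t_1:=0$. Let $(Y_k)_{k\ge1}$ be i.i.d. exponential random variables with parameter $1$, independent of $(t_k)_{k\ge2}$. Define $z_1:=1$ and $z_{k+1}:=z_k+Y_k e^{t_k}$ for $k\ge1$. Let $$\mathcal N:=\max\{i\ge1:\ t_j\le \log z_j \text{ for all } 1\le j\le i\}=\min\{i\ge 1:\ t_{i+1}>\log z_{i+1}\},\qquad F:=\log z_{\mathcal N+1}$$ ($\mathcal N$ is the cluster size and $F$ its log-endpoint). Let $\Psi(a,b;z)$ be the Tricomi confluent hypergeometric function (the confluent hypergeometric function of the second kind); for $a,z>0$ it equals $\Gamma(a)^{-1}\int_0^\infty e^{-zt}t^{a-1}(1+t)^{b-a-1}\,dt$, and for the other real $a$ it is the analytic continuation of this in $a$. Then $\mathcal N<\infty$ with probability $1$, and the following hold. 1. For every $(\lambda,\mu)\in D:=\{(\lambda,\mu)\in\mathbb R^2:\ \mathbb E(e^{\lambda\mathcal N+\mu F})<\infty\}$, one has $\Psi(-e^{\lambda},\mu;1)\neq0$ and $$\mathbb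 E\big(e^{\lambda\mathcal N+\mu F}\big)=e^{\lambda}\,\frac{\Psi(1-e^{\lambda},1+\mu;1)}{\Psi(-e^{\lambda},\mu;1)}.$$ 2. The set $D$ is open, convex, and contains $(0,0)$. 3. For all $\lambda,\mu\ge0$, the Laplace transform is finite, $\Psi(-e^{-\lambda},-\mu;1)\ne0$, and $$\mathbb E\big(e^{-\lambda\mathcal N-\mu F}\big)=e^{-\lambda}\,\frac{\Psi(1-e^{-\lambda},1-\mu;1)}{\Psi(-e^{-\lambda},-\mu;1)}.$$ 4. $\mathbb E(\mathcal N)=2$. -/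

import Mathlib

open MeasureTheory ProbabilityTheory

/-- The integral `Γ(a)⁻¹ ∫₀^∞ e^{-z t} t^{a-1} (1+t)^{b-a-1} dt`, which is the value at `(a, b; z)`
of the Tricomi function when `a > 0` and `z > 0`. -/
noncomputable def tricomiIntegral (a b z : ℝ) : ℝ :=
  (Real.Gamma a)⁻¹ *
    ∫ t in Set.Ioi (0 : ℝ), Real.exp (-(z * t)) * t ^ (a - 1) * (1 + t) ^ (b - a - 1)

/-- The Tricomi confluent hypergeometric function (of the second kind) `Ψ(a, b; z)`, also written
`U(a, b, z)`, for real `a`, `b` and for `z > 0`. For `a > 0` it is given by its integral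
representation. For `a ≤ 0` it is the analytic continuation of that integral in the parameter `a`,
which is computed by solving the contiguous relation
`Ψ(c-1, b; z) + (b - 2c - z) Ψ(c, b; z) + c (c - b + 1) Ψ(c+1, b; z) = 0`, at `c = a + 1`,
for its first term. -/
noncomputable def tricomiPsi (a b z : ℝ) : ℝ :=
  if 0 < a then tricomiIntegral a b z
  else (2 * (a + 1) + z - b) * tricomiPsi (a + 1) b z
    - (a + 1) * (a + 1 - b + 1) * tricomiPsi (a + 2) b z
termination_by ⌈1 - a⌉₊
decreasing_by
  all_goals
    rename_i h
    have h1 : ⌈1 - a⌉₊ = ⌈-a⌉₊ + 1 := by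
      rw [← Nat.ceil_add_one (by linarith), show -a + 1 = 1 - a by ring]
    rw [h1, Nat.lt_succ_iff]
    exact Nat.ceil_mono (by linarith)

section Cluster

variable {Ω : Type*}

/-- `t 0 = 0`, and `t 1 < t 2 < ⋯` are the points, in increasing order, of a Poisson point process
of rate `1` on `[0, ∞)`: the successive gaps are independent exponential variables of
parameter `1`. -/
structure IsPoissonPoints [MeasurableSpace Ω] (t : ℕ → Ω → ℝ) (P : Measure Ω) : Prop where
  measurable : ∀ k, Measurable (t k)
  zero : ∀ ω, t 0 ω = 0
  gap_law : ∀ k, HasLaw (fun ω => t (k + 1) ω - t k ω) (expMeasure 1) P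
  gap_indep : iIndepFun (fun k ω => t (k + 1) ω - t k ω) P

/-- The randomness of a cluster: the sequence `t` (`0` followed by the points of a Poisson process
of rate `1`), and independently of it a sequence `Y` of i.i.d. exponential variables of
parameter `1`. Sequences are indexed from `0`. -/
structure IsClusterInput [MeasurableSpace Ω] (t Y : ℕ → Ω → ℝ) (P : Measure Ω) : Prop where
  poisson : IsPoissonPoints t P
  measurable : ∀ k, Measurable (Y k)
  law : ∀ k, HasLaw (Y k) (expMeasure 1) P
  indep : iIndepFun Y P
  indep_poisson : IndepFun (fun ω k => Y k ω) (fun ω k => t k ω) P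

/-- `z 0 = 1` and `z (k + 1) = z k + Y k * e ^ (t k)`. -/
noncomputable def clusterZ (t Y : ℕ → Ω → ℝ) : ℕ → Ω → ℝ
  | 0 => fun _ => 1
  | k + 1 => fun ω => clusterZ t Y k ω + Y k ω * Real.exp (t k ω)

/-- The cluster size: the number of points `t 0, t 1, …` that come before the first one with
`t n > log (z n)`, that is, the first index `n` with `t n > log (z n)`.
(It has the default value `0` if there is no such `n`.) -/
noncomputable def clusterN (t Y : ℕ → Ω → ℝ) (ω : Ω) : ℕ :=
  sInf {n : ℕ | Real.log (clusterZ t Y n ω) < t n ω}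

/-- The log-endpoint of the cluster. As indices start at `0`, `z` at the index `clusterN` is the
term of the sequence `z` that follows the first `clusterN` terms. -/
noncomputable def clusterF (t Y : ℕ → Ω → ℝ) (ω : Ω) : ℝ :=
  Real.log (clusterZ t Y (clusterN t Y ω) ω)

/-- The set of `(l, m)` where the moment generating function of the pair
`(clusterN, clusterF)` is finite. -/
def mgfDomain [MeasurableSpace Ω] (t Y : ℕ → Ω → ℝ) (P : Measure Ω) : Set (ℝ × ℝ) :=
  {p | Integrable (fun ω => Real.exp (p.1 * (clusterN t Y ω : ℝ) + p.2 * clusterF t Y ω)) P}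

end Cluster

/-!
Put `x k = z k * e ^ (-t k)`. Then `x 0 = 1` and `x (k + 1) = (x k + Y k) * U k` with
`U k = e ^ (-(t (k + 1) - t k))` uniform on `(0, 1)`, so `x` is a Markov chain and the cluster ends
when it first falls below `1`. Write `s = e ^ l`, `μ = m`. The functional
`e ^ (l * N + m * F)` has mean `∑ₖ Kᵏ f` at `1`, where `K = stepOp s μ` is the weighted transition
operator of the chain killed below `1` and `f = exitFn s μ` is the contribution of an exit in one
step (`IsClusterInput.lintegral_exp`). In the same way the mean of `N` is `∑ₖ Kᵏ 1` for `s = 1`,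
`μ = 0`. Such a Green potential is the least nonnegative solution of `V = f + K V`.

With `G w = 1 + ∫₁ʷ v ^ (-μ) V v`, the equation `V = f + K V` becomes Kummer's equation
`x G'' + (μ - x) G' + s G = 0` on `[1, ∞)`, whose slowly growing solution is the Tricomi function
`φ = Ψ(-s, μ; ·)`. If `V` is finite, then `G` is positive; comparing Wronskians, `φ` is positive on
`[1, ∞)` as well (`IsKummerPair.pos_of_pos`). Therefore `x ^ μ φ' / φ 1` is a nonnegative solution
of the same fixed-point equation, and `V` is dominated by it, hence by a power of `x`
(`IsKummerPair.fixed_point`, `greenPotential_le`).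

A large power is contracted by `K` far out. Adding a multiple of `V`, one obtains a function `g`
that dominates a power and satisfies `K g ≤ q g` with `q < 1` (`exists_contraction`). This has three
consequences. The fixed-point equation has only one solution of at most this growth, which gives
the formula with `Ψ`. The potential stays finite when `s` is increased a little; together with
convexity and monotonicity this makes the domain of the moment generating function open. And for
`s = 1`, `μ = 0`, the explicit solution `2 + log x` of `V = 1 + K V` is the potential of `1`, so
that the mean of `N` is `2`.

The Tricomi function with negative first parameter is handled by induction along the contiguous
relation (`tricomi_param_induction`): the derivative, the relations to neighbouring parameters and
the behaviour at infinity are all transported from positive parameters, where they are read off the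
integral.
-/

open Set Filter Topology

open scoped ENNReal

/-! ### The Tricomi function -/

/-- The Laplace transform at `z` of `t ^ (α - 1) * (1 + t) ^ (β - 1)`; up to the factor `Γ(a)⁻¹`,
`tricomiIntegral a b z` is its value at `α = a`, `β = b - a`. -/
noncomputable def betaLaplace (α β z : ℝ) : ℝ :=
  ∫ t in Ioi (0 : ℝ), Real.exp (-(z * t)) * t ^ (α - 1) * (1 + t) ^ (β - 1)

lemma rpow_le_const_mul_exp {q ε u : ℝ} (hq : 0 < q) (hε : 0 < ε) (hu : 0 ≤ u) :
    u ^ q ≤ (q / ε) ^ q * Real.exp (ε * u) := by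
  have h1 : u = (q / ε) * (ε * u / q) := by field_simp
  have h2 : 0 ≤ ε * u / q := by positivity
  have h3 : ε * u / q ≤ Real.exp (ε * u / q) := by linarith [Real.add_one_le_exp (ε * u / q)]
  calc u ^ q = (q / ε) ^ q * (ε * u / q) ^ q := by
        conv_lhs => rw [h1]
        rw [Real.mul_rpow (by positivity) h2]
    _ ≤ (q / ε) ^ q * (Real.exp (ε * u / q)) ^ q := by gcongr
    _ = (q / ε) ^ q * Real.exp (ε * u) := by
        rw [← Real.exp_mul]; congr 2; field_simp

lemma exists_one_add_rpow_le (β : ℝ) {ε : ℝ} (hε : 0 < ε) :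
    ∃ C : ℝ, 0 < C ∧ ∀ t : ℝ, 0 ≤ t → (1 + t) ^ β ≤ C * Real.exp (ε * t) := by
  have hq : 0 < |β| + 1 := by positivity
  refine ⟨((|β| + 1) / ε) ^ (|β| + 1) * Real.exp ε, by positivity, fun t ht => ?_⟩
  calc (1 + t) ^ β ≤ (1 + t) ^ (|β| + 1) :=
        Real.rpow_le_rpow_of_exponent_le (by linarith) (by linarith [le_abs_self β])
    _ ≤ ((|β| + 1) / ε) ^ (|β| + 1) * Real.exp (ε * (1 + t)) :=
        rpow_le_const_mul_exp hq hε (by linarith)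
    _ = _ := by rw [mul_assoc, ← Real.exp_add]; ring_nf

lemma measurable_betaLaplace_integrand (α β z : ℝ) : Measurable
    (fun t : ℝ => Real.exp (-(z * t)) * t ^ (α - 1) * (1 + t) ^ (β - 1)) := by
  fun_prop

lemma integrableOn_betaLaplace {α z : ℝ} (β : ℝ) (hα : 0 < α) (hz : 0 < z) :
    IntegrableOn (fun t : ℝ => Real.exp (-(z * t)) * t ^ (α - 1) * (1 + t) ^ (β - 1))
      (Ioi 0) := by
  obtain ⟨C, hC, hle⟩ := exists_one_add_rpow_le (β - 1) (half_pos hz)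
  have h1 : IntegrableOn (fun t : ℝ => C * (t ^ (α - 1) * Real.exp (-(z / 2) * t))) (Ioi 0) := by
    have := integrableOn_rpow_mul_exp_neg_mul_rpow (p := 1) (s := α - 1) (b := z / 2)
      (by linarith) one_pos (by positivity)
    simp only [Real.rpow_one] at this
    exact this.const_mul C
  refine h1.mono' (measurable_betaLaplace_integrand α β z).aestronglyMeasurable ?_
  refine (ae_restrict_mem measurableSet_Ioi).mono fun t ht => ?_
  have ht' : (0 : ℝ) < t := ht
  rw [Real.norm_of_nonneg (by positivity)]
  calc Real.exp (-(z * t)) * t ^ (α - 1) * (1 + t) ^ (β - 1)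
      ≤ Real.exp (-(z * t)) * t ^ (α - 1) * (C * Real.exp (z / 2 * t)) := by
        gcongr; exact hle t ht'.le
    _ = C * (t ^ (α - 1) * (Real.exp (-(z * t)) * Real.exp (z / 2 * t))) := by ring
    _ = _ := by rw [← Real.exp_add]; ring_nf

lemma betaLaplace_add {α z : ℝ} (β : ℝ) (hα : 0 < α) (hz : 0 < z) :
    betaLaplace α (β + 1) z = betaLaplace (α + 1) β z + betaLaplace α β z := by
  unfold betaLaplace
  rw [← integral_add (integrableOn_betaLaplace β (by linarith) hz)
    (integrableOn_betaLaplace β hα hz)]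
  refine setIntegral_congr_fun measurableSet_Ioi fun t ht => ?_
  have ht' : (0 : ℝ) < t := ht
  have e1 : t ^ (α + 1 - 1) = t ^ (α - 1) * t := by
    rw [← Real.rpow_add_one ht'.ne']; ring_nf
  have e2 : (1 + t) ^ (β + 1 - 1) = (1 + t) ^ (β - 1) * (1 + t) := by
    rw [← Real.rpow_add_one (by positivity)]; ring_nf
  simp only [e1, e2]; ring

/-- Integration by parts. -/
lemma betaLaplace_parts {α z : ℝ} (β : ℝ) (hα : 0 < α) (hz : 0 < z) :
    z * betaLaplace (α + 1) (β + 1) z =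
      α * betaLaplace α (β + 1) z + β * betaLaplace (α + 1) β z := by
  set F : ℝ → ℝ := fun t => Real.exp (-(z * t)) * t ^ α * (1 + t) ^ β with hF
  set F' : ℝ → ℝ := fun t =>
    -z * (Real.exp (-(z * t)) * t ^ (α + 1 - 1) * (1 + t) ^ (β + 1 - 1))
    + (α * (Real.exp (-(z * t)) * t ^ (α - 1) * (1 + t) ^ (β + 1 - 1))
    + β * (Real.exp (-(z * t)) * t ^ (α + 1 - 1) * (1 + t) ^ (β - 1))) with hF'
  have i1 := (integrableOn_betaLaplace (α := α + 1) (z := z) (β + 1)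
    (by linarith) hz).const_mul (-z)
  have i2 := (integrableOn_betaLaplace (z := z) (β + 1) hα hz).const_mul α
  have i3 := (integrableOn_betaLaplace (α := α + 1) (z := z) β (by linarith) hz).const_mul β
  have hd : ∀ t ∈ Ioi (0 : ℝ), HasDerivAt F (F' t) t := by
    intro t ht
    have ht' : (0 : ℝ) < t := ht
    have d1 : HasDerivAt (fun t : ℝ => Real.exp (-(z * t))) (Real.exp (-(z * t)) * (-z)) t := by
      have : HasDerivAt (fun t : ℝ => -(z * t)) (-z) t := by
        simpa using ((hasDerivAt_id t).const_mul z).fun_neg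
      exact this.exp
    have d2 : HasDerivAt (fun t : ℝ => t ^ α) (α * t ^ (α - 1)) t :=
      Real.hasDerivAt_rpow_const (Or.inl ht'.ne')
    have d3 : HasDerivAt (fun t : ℝ => (1 + t) ^ β) (β * (1 + t) ^ (β - 1)) t := by
      have := ((hasDerivAt_id t).const_add 1).rpow_const (p := β)
        (Or.inl (by simp only [id]; positivity))
      simpa using this
    refine ((d1.mul d2).mul d3).congr_deriv ?_
    simp only [hF', add_sub_cancel_right, Pi.mul_apply]; ring
  have hc : ContinuousWithinAt F (Ici 0) 0 := by
    refine ContinuousAt.continuousWithinAt ?_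
    refine ((by fun_prop : ContinuousAt (fun t : ℝ => Real.exp (-(z * t))) 0).mul
      (Real.continuousAt_rpow_const 0 α (Or.inr hα.le))).mul ?_
    exact ContinuousAt.rpow_const (by fun_prop) (Or.inl (by norm_num))
  have ht : Tendsto F atTop (𝓝 0) := by
    obtain ⟨C, hC, hle⟩ := exists_one_add_rpow_le β (half_pos hz)
    have h1 := (tendsto_rpow_mul_exp_neg_mul_atTop_nhds_zero α (z / 2) (half_pos hz)).const_mul C
    rw [mul_zero] at h1
    refine tendsto_of_tendsto_of_tendsto_of_le_of_le' tendsto_const_nhds h1 ?_ ?_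
    · filter_upwards [eventually_gt_atTop 0] with t ht; simp only [hF]; positivity
    · filter_upwards [eventually_gt_atTop 0] with t ht
      calc F t ≤ Real.exp (-(z * t)) * t ^ α * (C * Real.exp (z / 2 * t)) := by
            simp only [hF]; gcongr; exact hle t ht.le
        _ = C * (t ^ α * (Real.exp (-(z * t)) * Real.exp (z / 2 * t))) := by ring
        _ = _ := by rw [← Real.exp_add]; ring_nf
  have key := integral_Ioi_of_hasDerivAt_of_tendsto hc hd (i1.add (i2.add i3)) ht
  have hF0 : F 0 = 0 := by simp [hF, Real.zero_rpow hα.ne']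
  have i23 := i2.add i3
  rw [hF0, sub_zero] at key
  have split : ∫ t in Ioi (0:ℝ), F' t = -z * betaLaplace (α + 1) (β + 1) z +
      (α * betaLaplace α (β + 1) z + β * betaLaplace (α + 1) β z) := by
    simp only [betaLaplace, hF', ← integral_const_mul]
    exact (integral_add i1 i23).trans (congrArg _ (integral_add i2 i3))
  linarith [split.symm.trans key]

lemma hasDerivAt_betaLaplace {α z : ℝ} (β : ℝ) (hα : 0 < α) (hz : 0 < z) :
    HasDerivAt (betaLaplace α β) (-betaLaplace (α + 1) β z) z := by
  have hev : ∀ x ∈ Metric.ball z (z / 2), z / 2 < x := by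
    intro x hx
    rw [Metric.mem_ball, Real.dist_eq, abs_lt] at hx; linarith
  have hd : ∀ t ∈ Ioi (0:ℝ), ∀ x : ℝ, HasDerivAt
      (fun x : ℝ => Real.exp (-(x * t)) * t ^ (α - 1) * (1 + t) ^ (β - 1))
      (-(Real.exp (-(x * t)) * t ^ (α + 1 - 1) * (1 + t) ^ (β - 1))) x := by
    intro t ht x
    have ht' : (0 : ℝ) < t := ht
    have d1 : HasDerivAt (fun x : ℝ => Real.exp (-(x * t))) (Real.exp (-(x * t)) * (-t)) x := by
      have : HasDerivAt (fun x : ℝ => -(x * t)) (-t) x := by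
        simpa using ((hasDerivAt_id x).mul_const t).fun_neg
      exact this.exp
    have e1 : t ^ (α + 1 - 1) = t ^ (α - 1) * t := by
      rw [← Real.rpow_add_one ht'.ne']; ring_nf
    refine ((d1.mul_const _).mul_const _).congr_deriv ?_
    rw [e1]; ring
  have := hasDerivAt_integral_of_dominated_loc_of_deriv_le (μ := volume.restrict (Ioi (0:ℝ)))
    (F := fun x t => Real.exp (-(x * t)) * t ^ (α - 1) * (1 + t) ^ (β - 1))
    (F' := fun x t => -(Real.exp (-(x * t)) * t ^ (α + 1 - 1) * (1 + t) ^ (β - 1)))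
    (bound := fun t => Real.exp (-(z / 2 * t)) * t ^ (α + 1 - 1) * (1 + t) ^ (β - 1))
    (x₀ := z) (Metric.ball_mem_nhds z (half_pos hz))
    (Eventually.of_forall fun x => (measurable_betaLaplace_integrand α β x).aestronglyMeasurable)
    (integrableOn_betaLaplace β hα hz)
    (measurable_betaLaplace_integrand (α + 1) β z).neg.aestronglyMeasurable
    ((ae_restrict_mem measurableSet_Ioi).mono fun t ht x hx => ?_)
    (integrableOn_betaLaplace β (by linarith) (half_pos hz))
    ((ae_restrict_mem measurableSet_Ioi).mono fun t ht x hx => hd t ht x)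
  · refine this.2.congr_deriv ?_
    rw [integral_neg]; rfl
  · have ht' : (0 : ℝ) < t := ht
    rw [norm_neg, Real.norm_of_nonneg (by positivity)]
    gcongr
    exact (hev x hx).le

/-- As `z → ∞` the mass of the Laplace transform concentrates at `t = 0`. -/
lemma tendsto_rpow_mul_betaLaplace {α : ℝ} (β : ℝ) (hα : 0 < α) :
    Tendsto (fun z : ℝ => z ^ α * betaLaplace α β z) atTop (𝓝 (Real.Gamma α)) := by
  have hsub : ∀ z : ℝ, 0 < z → z ^ α * betaLaplace α β z =
      ∫ u in Ioi (0:ℝ), Real.exp (-u) * u ^ (α - 1) * (1 + z⁻¹ * u) ^ (β - 1) := by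
    intro z hz
    have := integral_comp_mul_left_Ioi
      (fun u => Real.exp (-u) * u ^ (α - 1) * (1 + z⁻¹ * u) ^ (β - 1)) 0 hz
    rw [mul_zero, smul_eq_mul, eq_comm, inv_mul_eq_iff_eq_mul₀ hz.ne'] at this
    rw [this]
    unfold betaLaplace
    rw [← integral_const_mul, ← integral_const_mul]
    refine setIntegral_congr_fun measurableSet_Ioi fun t ht => ?_
    have ht' : (0 : ℝ) < t := ht
    have e1 : z ^ α = z ^ (α - 1) * z := by
      rw [← Real.rpow_add_one hz.ne']; ring_nf
    have e2 : z⁻¹ * (z * t) = t := by field_simp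
    simp only [e2, e1, Real.mul_rpow hz.le ht'.le]
    ring
  have hlim : Tendsto (fun z : ℝ =>
      ∫ u in Ioi (0:ℝ), Real.exp (-u) * u ^ (α - 1) * (1 + z⁻¹ * u) ^ (β - 1)) atTop
      (𝓝 (∫ u in Ioi (0:ℝ), Real.exp (-u) * u ^ (α - 1))) := by
    refine tendsto_integral_filter_of_dominated_convergence
      (fun u => Real.exp (-(1 * u)) * u ^ (α - 1) * (1 + u) ^ ((|β - 1| + 1) - 1))
      (Eventually.of_forall fun z => (by fun_prop : Measurable _).aestronglyMeasurable) ?_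
      (integrableOn_betaLaplace _ hα one_pos) ?_
    · filter_upwards [eventually_ge_atTop 1] with z hz
      refine (ae_restrict_mem measurableSet_Ioi).mono fun u hu => ?_
      have hu' : (0 : ℝ) < u := hu
      have hz0 : (0 : ℝ) < z := by linarith
      have hzu : z⁻¹ * u ≤ u := by
        have : z⁻¹ ≤ 1 := inv_le_one_of_one_le₀ hz
        nlinarith
      rw [Real.norm_of_nonneg (by positivity), one_mul, add_sub_cancel_right]
      gcongr
      calc (1 + z⁻¹ * u) ^ (β - 1) ≤ (1 + z⁻¹ * u) ^ |β - 1| :=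
            Real.rpow_le_rpow_of_exponent_le (by
              have : 0 < z⁻¹ * u := by positivity
              linarith) (le_abs_self _)
        _ ≤ (1 + u) ^ |β - 1| := by gcongr
    · refine (ae_restrict_mem measurableSet_Ioi).mono fun u hu => ?_
      have h1 : Tendsto (fun z : ℝ => 1 + z⁻¹ * u) atTop (𝓝 1) := by
        simpa using (tendsto_inv_atTop_zero.mul_const u).const_add 1
      have h2 : Tendsto (fun z : ℝ => (1 + z⁻¹ * u) ^ (β - 1)) atTop (𝓝 1) := by
        simpa using h1.rpow_const (p := β - 1) (Or.inl one_ne_zero)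
      simpa using h2.const_mul (Real.exp (-u) * u ^ (α - 1))
  rw [Real.Gamma_eq_integral hα]
  exact hlim.congr' (by filter_upwards [eventually_gt_atTop 0] with z hz using (hsub z hz).symm)

lemma tricomiPsi_of_pos {a : ℝ} (b z : ℝ) (ha : 0 < a) :
    tricomiPsi a b z = (Real.Gamma a)⁻¹ * betaLaplace a (b - a) z := by
  rw [tricomiPsi, if_pos ha]; rfl

/-- The contiguous relation, for every value of the first parameter. -/
lemma tricomiPsi_contiguous (a b : ℝ) {z : ℝ} (hz : 0 < z) :
    tricomiPsi a b z = (2 * (a + 1) + z - b) * tricomiPsi (a + 1) b z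
      - (a + 1) * (a + 1 - b + 1) * tricomiPsi (a + 2) b z := by
  by_cases ha : 0 < a
  · rw [tricomiPsi_of_pos b z ha, tricomiPsi_of_pos b z (by linarith : 0 < a + 1),
      tricomiPsi_of_pos b z (by linarith : 0 < a + 2)]
    have hG := (Real.Gamma_pos_of_pos ha).ne'
    have e1 : Real.Gamma (a + 1) = a * Real.Gamma a := Real.Gamma_add_one ha.ne'
    have e2 : Real.Gamma (a + 2) = (a + 1) * (a * Real.Gamma a) := by
      rw [← e1, ← Real.Gamma_add_one (by linarith : a + 1 ≠ 0)]; ring_nf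
    have r1 := betaLaplace_parts (b - a - 1) ha hz
    have r2 := betaLaplace_parts (α := a + 1) (b - a - 2) (by linarith) hz
    have r3 := betaLaplace_add (α := a + 1) (b - a - 1) (by linarith) hz
    have n1 : a + 1 + 1 = a + 2 := by ring
    have n2 : b - a - 1 + 1 = b - a := by ring
    have n3 : b - a - 2 + 1 = b - a - 1 := by ring
    have n4 : b - (a + 1) = b - a - 1 := by ring
    have n5 : b - (a + 2) = b - a - 2 := by ring
    rw [n1, n2] at r3
    rw [n2] at r1
    rw [n1, n3] at r2
    rw [e1, e2, n4, n5]
    have ha1 : a + 1 ≠ 0 := by linarith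
    have key : a * betaLaplace a (b - a) z =
        (2 * (a + 1) + z - b) * betaLaplace (a + 1) (b - a - 1) z
        - (a + 1 - b + 1) * betaLaplace (a + 2) (b - a - 2) z := by
      linear_combination (-1 : ℝ) * r1 + z * r3 + r2
    field_simp
    linear_combination key
  · conv_lhs => rw [tricomiPsi, if_neg ha]

/-- A property of the first parameter of the Tricomi function that holds for positive values, and
that the contiguous relation carries from `a + 1` and `a + 2` to `a`, holds for all values. -/
lemma tricomi_param_induction {p : ℝ → Prop} (hpos : ∀ a, 0 < a → p a)
    (hstep : ∀ a, p (a + 1) → p (a + 2) → p a) (a : ℝ) : p a := by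
  have key : ∀ n : ℕ, ∀ a : ℝ, -(n : ℝ) < a → p a := by
    intro n
    induction n with
    | zero => intro a ha; exact hpos a (by simpa using ha)
    | succ n ih =>
      intro a ha
      push_cast at ha
      exact hstep a (ih _ (by linarith)) (ih _ (by linarith))
  obtain ⟨n, hn⟩ := exists_nat_gt (-a)
  exact key n a (by linarith)

lemma tricomiPsi_add_one_right (a b : ℝ) {z : ℝ} (hz : 0 < z) :
    tricomiPsi a (b + 1) z = tricomiPsi a b z + a * tricomiPsi (a + 1) (b + 1) z := by
  refine tricomi_param_induction (p := fun a => tricomiPsi a (b + 1) z =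
    tricomiPsi a b z + a * tricomiPsi (a + 1) (b + 1) z) (fun a ha => ?_) (fun a h1 h2 => ?_) a
  · rw [tricomiPsi_of_pos _ z ha, tricomiPsi_of_pos _ z ha,
      tricomiPsi_of_pos _ z (by linarith : 0 < a + 1), Real.Gamma_add_one ha.ne']
    have hG := (Real.Gamma_pos_of_pos ha).ne'
    have r := betaLaplace_add (b - a) ha hz
    rw [show b + 1 - a = b - a + 1 by ring, show b + 1 - (a + 1) = b - a by ring, r]
    field_simp
    ring
  · have c1 := tricomiPsi_contiguous a (b + 1) hz
    have c2 := tricomiPsi_contiguous a b hz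
    have c3 := tricomiPsi_contiguous (a + 1) (b + 1) hz
    rw [show a + 1 + 1 = a + 2 by ring, show a + 1 + 2 = a + 3 by ring] at c3
    rw [show a + 1 + 1 = a + 2 by ring] at h1
    rw [show a + 2 + 1 = a + 3 by ring] at h2
    linear_combination c1 - c2 + (2 * (a + 1) + z - b) * h1 - (a + 1) * (a + 2 - b) * h2
      - (a + 1) * c3

/-- A relation between three points on a diagonal of the parameter plane. -/
lemma tricomiPsi_diagonal (a b : ℝ) {z : ℝ} (hz : 0 < z) :
    z * (a * tricomiPsi (a + 1) (b + 1) z) =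
      tricomiPsi (a - 1) (b - 1) z - (z - b + 1) * tricomiPsi a b z := by
  have q1 := tricomiPsi_add_one_right (a - 1) (b - 1) hz
  have q2 := tricomiPsi_add_one_right a b hz
  have q3 := tricomiPsi_add_one_right (a + 1) b hz
  have c1 := tricomiPsi_contiguous (a - 1) b hz
  have c2 := tricomiPsi_contiguous a (b + 1) hz
  simp only [show a - 1 + 1 = a by ring, show b - 1 + 1 = b by ring,
    show a - 1 + 2 = a + 1 by ring, show a + 1 + 1 = a + 2 by ring] at *
  linear_combination q1 - c1 + a * (q2 - c2 - (1 + a - b) * q3)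

lemma hasDerivAt_tricomiPsi (a b : ℝ) {z : ℝ} (hz : 0 < z) :
    HasDerivAt (tricomiPsi a b) (-a * tricomiPsi (a + 1) (b + 1) z) z := by
  refine tricomi_param_induction (p := fun a =>
    HasDerivAt (tricomiPsi a b) (-a * tricomiPsi (a + 1) (b + 1) z) z)
    (fun a ha => ?_) (fun a h1 h2 => ?_) a
  · have : tricomiPsi a b = fun z => (Real.Gamma a)⁻¹ * betaLaplace a (b - a) z := by
      ext z; exact tricomiPsi_of_pos b z ha
    rw [this, tricomiPsi_of_pos _ z (by linarith : 0 < a + 1), Real.Gamma_add_one ha.ne']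
    refine ((hasDerivAt_betaLaplace (b - a) ha hz).const_mul _).congr_deriv ?_
    have hG := (Real.Gamma_pos_of_pos ha).ne'
    rw [show b + 1 - (a + 1) = b - a by ring]
    field_simp
  · have hloc : tricomiPsi a b =ᶠ[𝓝 z] fun z => (2 * (a + 1) + z - b) * tricomiPsi (a + 1) b z
        - (a + 1) * (a + 1 - b + 1) * tricomiPsi (a + 2) b z := by
      filter_upwards [lt_mem_nhds hz] with x hx using tricomiPsi_contiguous a b hx
    have d0 : HasDerivAt (fun z : ℝ => 2 * (a + 1) + z - b) 1 z := by
      simpa using ((hasDerivAt_id z).const_add (2 * (a + 1))).sub_const b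
    refine HasDerivAt.congr_of_eventuallyEq (((d0.mul h1).sub (h2.const_mul _)).congr_deriv ?_) hloc
    have q := tricomiPsi_add_one_right (a + 1) b hz
    have c3 := tricomiPsi_contiguous (a + 1) (b + 1) hz
    simp only [show a + 1 + 1 = a + 2 by ring, show a + 1 + 2 = a + 3 by ring,
      show a + 2 + 1 = a + 3 by ring] at *
    linear_combination (a + 1) * c3 - q

lemma tendsto_rpow_mul_tricomiPsi (a b : ℝ) :
    Tendsto (fun z : ℝ => z ^ a * tricomiPsi a b z) atTop (𝓝 1) := by
  refine tricomi_param_induction (p := fun a =>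
    Tendsto (fun z : ℝ => z ^ a * tricomiPsi a b z) atTop (𝓝 1))
    (fun a ha => ?_) (fun a h1 h2 => ?_) a
  · have h := (tendsto_rpow_mul_betaLaplace (b - a) ha).const_mul (Real.Gamma a)⁻¹
    rw [inv_mul_cancel₀ (Real.Gamma_pos_of_pos ha).ne'] at h
    refine h.congr fun z => ?_
    rw [tricomiPsi_of_pos _ z ha]; ring
  · have t0 := tendsto_inv_atTop_zero (𝕜 := ℝ)
    have h := (((t0.const_mul (2 * (a + 1) - b)).const_add 1).mul h1).sub
      (((t0.mul t0).const_mul ((a + 1) * (a + 1 - b + 1))).mul h2)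
    simp only [mul_zero, add_zero, mul_one, sub_zero] at h
    refine h.congr' ?_
    filter_upwards [eventually_gt_atTop 0] with z hz
    rw [tricomiPsi_contiguous a b hz, Real.rpow_add_one hz.ne',
      show a + 2 = a + 1 + 1 by ring, Real.rpow_add_one hz.ne', Real.rpow_add_one hz.ne']
    field_simp
    ring

/-! ### Solutions of Kummer's equation -/

/-- A solution `φ` of Kummer's equation `x φ'' + (μ - x) φ' + s φ = 0` on `[1, ∞)`, written as a
first order system: `J = s⁻¹ x ^ μ e ^ (-x) φ'` is the normalized flux of `φ`. -/
structure IsKummerPair (s μ : ℝ) (φ J : ℝ → ℝ) : Prop where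
  deriv_fst : ∀ x, 1 ≤ x → HasDerivAt φ (s * Real.exp x * x ^ (-μ) * J x) x
  deriv_snd : ∀ x, 1 ≤ x → HasDerivAt J (-(Real.exp (-x) * x ^ (μ - 1) * φ x)) x

/-- The flux of the Tricomi solution `Ψ(-s, μ; ·)`, whose derivative is
`s * Ψ(1 - s, 1 + μ; ·)`. -/
noncomputable def tricomiFlux (s μ x : ℝ) : ℝ :=
  x ^ μ * Real.exp (-x) * tricomiPsi (1 - s) (1 + μ) x

lemma isKummerPair_tricomi (s μ : ℝ) :
    IsKummerPair s μ (tricomiPsi (-s) μ) (tricomiFlux s μ) where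
  deriv_fst x hx := by
    have hx0 : 0 < x := by linarith
    refine (hasDerivAt_tricomiPsi (-s) μ hx0).congr_deriv ?_
    have e1 : x ^ (-μ) * x ^ μ = 1 := by rw [← Real.rpow_add hx0]; simp
    have e2 : Real.exp x * Real.exp (-x) = 1 := by rw [← Real.exp_add]; simp
    rw [tricomiFlux, show -s + 1 = 1 - s by ring, add_comm μ 1]
    linear_combination (-(s * tricomiPsi (1 - s) (1 + μ) x)) *
      (x ^ (-μ) * x ^ μ * e2 + e1)
  deriv_snd x hx := by
    have hx0 : 0 < x := by linarith
    have d1 : HasDerivAt (fun x : ℝ => x ^ μ) (μ * x ^ (μ - 1)) x :=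
      Real.hasDerivAt_rpow_const (Or.inl hx0.ne')
    have d2 : HasDerivAt (fun x : ℝ => Real.exp (-x)) (Real.exp (-x) * (-1)) x :=
      (hasDerivAt_neg x).exp
    refine ((d1.mul d2).mul (hasDerivAt_tricomiPsi (1 - s) (1 + μ) hx0)).congr_deriv ?_
    have e1 : x ^ μ = x ^ (μ - 1) * x := by rw [← Real.rpow_add_one hx0.ne']; ring_nf
    have e2 := tricomiPsi_diagonal (1 - s) (1 + μ) hx0
    rw [show (1 - s - 1) = -s by ring, show 1 + μ - 1 = μ by ring] at e2
    simp only [Pi.mul_apply, e1]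
    linear_combination (-(x ^ (μ - 1) * Real.exp (-x))) * e2

/-- The Wronskian of two solutions. -/
lemma IsKummerPair.wronskian {s μ : ℝ} {φ J G j : ℝ → ℝ} (h : IsKummerPair s μ φ J)
    (h' : IsKummerPair s μ G j) {x : ℝ} (hx : 1 ≤ x) :
    j x * φ x - J x * G x = j 1 * φ 1 - J 1 * G 1 := by
  have hd : ∀ x, 1 ≤ x → HasDerivAt (fun x => j x * φ x - J x * G x) 0 x := by
    intro x hx
    refine (((h'.deriv_snd x hx).mul (h.deriv_fst x hx)).sub
      ((h.deriv_snd x hx).mul (h'.deriv_fst x hx))).congr_deriv ?_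
    ring
  exact constant_of_has_deriv_right_zero
    (f := fun x => j x * φ x - J x * G x) (a := 1) (b := x)
    (fun y hy => (hd y hy.1).continuousAt.continuousWithinAt)
    (fun y hy => (hd y hy.1).hasDerivWithinAt) x ⟨hx, le_rfl⟩

/-- If Kummer's equation has a positive solution on `[1, ∞)`, then a solution that is eventually
positive and grows slowly is positive on all of `[1, ∞)`. -/
lemma IsKummerPair.pos_of_pos {s μ : ℝ} (hs : 0 < s) {φ J G j : ℝ → ℝ} (h : IsKummerPair s μ φ J)
    (h' : IsKummerPair s μ G j) (hG : ∀ x, 1 ≤ x → 0 < G x)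
    (hpos : ∀ᶠ x in atTop, 0 < φ x)
    (hslow : Tendsto (fun x => φ x ^ 2 * x ^ μ * Real.exp (-x)) atTop (𝓝 0))
    {x : ℝ} (hx : 1 ≤ x) : 0 < φ x := by
  set W := j 1 * φ 1 - J 1 * G 1 with hW
  have hWr : ∀ x, 1 ≤ x → j x * φ x - J x * G x = W := fun x hx => h.wronskian h' hx
  have hWnn : 0 ≤ W := by
    -- otherwise `G / φ` decreases to `-∞`
    by_contra hneg
    push Not at hneg
    have hev := (hslow.eventually (gt_mem_nhds one_pos)).and hpos
    obtain ⟨X, hX⟩ := eventually_atTop.1 hev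
    set X' := max X 1
    have hd : ∀ x, X' ≤ x → HasDerivAt (fun x => G x / φ x)
        (s * Real.exp x * x ^ (-μ) * W / φ x ^ 2) x := by
      intro x hx
      have hx1 : 1 ≤ x := le_trans (le_max_right _ _) hx
      have hφ := (hX x (le_trans (le_max_left _ _) hx)).2
      refine ((h'.deriv_fst x hx1).div (h.deriv_fst x hx1) hφ.ne').congr_deriv ?_
      rw [← hWr x hx1]; ring
    have hle : ∀ x, X' ≤ x → s * Real.exp x * x ^ (-μ) * W / φ x ^ 2 ≤ s * W := by
      intro x hx
      have hx1 : 1 ≤ x := le_trans (le_max_right _ _) hx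
      have hx0 : 0 < x := by linarith
      obtain ⟨h1, hφ⟩ := hX x (le_trans (le_max_left _ _) hx)
      rw [div_le_iff₀ (by positivity)]
      have h2 : φ x ^ 2 ≤ Real.exp x * x ^ (-μ) := by
        rw [Real.exp_neg, ← div_eq_mul_inv, div_lt_one (Real.exp_pos x)] at h1
        rw [Real.rpow_neg hx0.le, ← div_eq_mul_inv, le_div_iff₀ (by positivity)]
        exact h1.le
      have h3 : s * W < 0 := mul_neg_of_pos_of_neg hs hneg
      nlinarith
    have hbd : ∀ x, X' ≤ x → G x / φ x ≤ G X' / φ X' + s * W * (x - X') := by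
      intro x hx
      have := Convex.image_sub_le_mul_sub_of_deriv_le (convex_Ici X')
        (f := fun x => G x / φ x) (C := s * W)
        (fun y hy => (hd y hy).continuousAt.continuousWithinAt)
        (fun y hy => (hd y (interior_subset hy)).differentiableAt.differentiableWithinAt)
        (fun y hy => by
          rw [(hd y (interior_subset hy)).deriv]; exact hle y (interior_subset hy))
        X' (by simp) x hx hx
      linarith
    have h3 : s * W < 0 := mul_neg_of_pos_of_neg hs hneg
    set c := G X' / φ X'
    have hc : 0 < c := div_pos (hG _ (le_max_right _ _)) (hX _ (le_max_left _ _)).2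
    have hx' : X' ≤ X' + c / (-(s * W)) := by
      have : 0 < c / (-(s * W)) := div_pos hc (by linarith)
      linarith
    have h4 := hbd _ hx'
    have h5 : 0 < G (X' + c / (-(s * W))) / φ (X' + c / (-(s * W))) :=
      div_pos (hG _ (le_trans (le_max_right _ _) hx')) (hX _ (le_trans (le_max_left _ _) hx')).2
    have h6 : s * W * (X' + c / (-(s * W)) - X') = -c := by
      have h7 : W ≠ 0 := hneg.ne
      field_simp
      ring
    linarith
  have hd : ∀ x, 1 ≤ x → HasDerivAt (fun x => φ x / G x)
      (-(s * Real.exp x * x ^ (-μ) * W / G x ^ 2)) x := by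
    intro x hx
    refine ((h.deriv_fst x hx).div (h'.deriv_fst x hx) (hG x hx).ne').congr_deriv ?_
    rw [← hWr x hx]; ring
  have hanti : AntitoneOn (fun x => φ x / G x) (Ici 1) := by
    refine antitoneOn_of_deriv_nonpos (convex_Ici 1)
      (fun y hy => (hd y hy).continuousAt.continuousWithinAt)
      (fun y hy => (hd y (interior_subset hy)).differentiableAt.differentiableWithinAt)
      (fun y hy => ?_)
    have hy0 : (0 : ℝ) < y := lt_of_lt_of_le one_pos (interior_subset hy)
    rw [(hd y (interior_subset hy)).deriv, neg_nonpos]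
    positivity
  obtain ⟨X, hX, hXx⟩ := (hpos.and (eventually_ge_atTop x)).exists
  have h1 : φ X / G X ≤ φ x / G x := hanti hx (le_trans hx hXx) hXx
  have h2 : 0 < φ X / G X := div_pos hX (hG _ (le_trans hx hXx))
  have := mul_pos (lt_of_lt_of_le h2 h1) (hG x hx)
  rwa [div_mul_cancel₀ _ (hG x hx).ne'] at this

/-! ### The transition operator of the killed chain -/

/-- The weight `e ^ (-w) w ^ (μ - 1)`. -/
noncomputable def tiltedWeight (μ w : ℝ) : ℝ := Real.exp (-w) * w ^ (μ - 1)

/-- For the chain `x ↦ U (x + Y)` on `[1, ∞)`, with `U` uniform on `(0, 1)` and `Y` exponential,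
killed when it leaves `[1, ∞)`: the operator that maps `f` to
`x ↦ s * 𝔼[U ^ (-μ) * f (U * (x + Y)); U * (x + Y) ≥ 1]`, written in the variables `w = x + Y` and
`v = U * w`. -/
noncomputable def stepOp (s μ : ℝ) (f : ℝ → ℝ≥0∞) (x : ℝ) : ℝ≥0∞ :=
  ENNReal.ofReal (s * Real.exp x) * ∫⁻ w in Ioi x, ENNReal.ofReal (tiltedWeight μ w) *
    ∫⁻ v in Ioc 1 w, ENNReal.ofReal (v ^ (-μ)) * f v

/-- The contribution `s * 𝔼[(x + Y) ^ μ; U * (x + Y) < 1]` of the paths that leave `[1, ∞)` in one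
step from `x`. -/
noncomputable def exitFn (s μ x : ℝ) : ℝ≥0∞ :=
  ENNReal.ofReal (s * Real.exp x) * ∫⁻ w in Ioi x, ENNReal.ofReal (tiltedWeight μ w)

/-- The Green potential `∑ₖ Kᵏ f` of `f`, for `K = stepOp s μ`. -/
noncomputable def greenPotential (s μ : ℝ) (f : ℝ → ℝ≥0∞) (x : ℝ) : ℝ≥0∞ :=
  ∑' k : ℕ, (stepOp s μ)^[k] f x

lemma tiltedWeight_pos (μ : ℝ) {w : ℝ} (hw : 0 < w) : 0 < tiltedWeight μ w := by
  unfold tiltedWeight; positivity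

@[fun_prop]
lemma measurable_tiltedWeight (μ : ℝ) : Measurable (tiltedWeight μ) := by
  unfold tiltedWeight; fun_prop

lemma measurable_setLIntegral_Ioi (f : ℝ → ℝ≥0∞) : Measurable fun x => ∫⁻ w in Ioi x, f w :=
  Antitone.measurable fun _ _ hxy => lintegral_mono_set (Ioi_subset_Ioi hxy)

@[fun_prop]
lemma measurable_setLIntegral_Ioc (f : ℝ → ℝ≥0∞) : Measurable fun w => ∫⁻ v in Ioc 1 w, f v :=
  Monotone.measurable fun _ _ hxy => lintegral_mono_set (Ioc_subset_Ioc_right hxy)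

lemma measurable_exitFn (s μ : ℝ) : Measurable (exitFn s μ) :=
  (by fun_prop : Measurable fun x : ℝ => ENNReal.ofReal (s * Real.exp x)).mul
    (measurable_setLIntegral_Ioi _)

lemma measurable_stepOp (s μ : ℝ) (f : ℝ → ℝ≥0∞) : Measurable (stepOp s μ f) :=
  (by fun_prop : Measurable fun x : ℝ => ENNReal.ofReal (s * Real.exp x)).mul
    (measurable_setLIntegral_Ioi _)

lemma measurable_iterate_stepOp (s μ : ℝ) {f : ℝ → ℝ≥0∞} (hf : Measurable f) (n : ℕ) :
    Measurable ((stepOp s μ)^[n] f) := by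
  cases n with
  | zero => exact hf
  | succ n => rw [Function.iterate_succ_apply']; exact measurable_stepOp s μ _

lemma measurable_greenPotential (s μ : ℝ) {f : ℝ → ℝ≥0∞} (hf : Measurable f) :
    Measurable (greenPotential s μ f) :=
  Measurable.tsum fun n => measurable_iterate_stepOp s μ hf n

lemma stepOp_mono {s μ : ℝ} {f g : ℝ → ℝ≥0∞} (h : ∀ x, 1 ≤ x → f x ≤ g x) (x : ℝ) :
    stepOp s μ f x ≤ stepOp s μ g x := by
  exact mul_le_mul_right (setLIntegral_mono' measurableSet_Ioi fun w _ =>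
    mul_le_mul_right (setLIntegral_mono' measurableSet_Ioc fun v hv =>
      mul_le_mul_right (h v hv.1.le) _) _) _

lemma stepOp_add (s μ : ℝ) {f : ℝ → ℝ≥0∞} (hf : Measurable f) (g : ℝ → ℝ≥0∞) (x : ℝ) :
    stepOp s μ (fun y => f y + g y) x = stepOp s μ f x + stepOp s μ g x := by
  unfold stepOp
  rw [← mul_add, ← lintegral_add_left (by fun_prop)]
  congr 2
  ext w
  rw [← mul_add, ← lintegral_add_left (by fun_prop)]
  simp only [mul_add]

lemma stepOp_const_mul (s μ : ℝ) (c : ℝ≥0∞) {f : ℝ → ℝ≥0∞} (hf : Measurable f) (x : ℝ) :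
    stepOp s μ (fun y => c * f y) x = c * stepOp s μ f x := by
  unfold stepOp
  rw [mul_left_comm c, ← lintegral_const_mul c (by fun_prop)]
  congr 2
  ext w
  rw [mul_left_comm c, ← lintegral_const_mul c (by fun_prop)]
  simp only [mul_left_comm c]

lemma stepOp_mul_left {c : ℝ} (hc : 0 ≤ c) (s μ : ℝ) (f : ℝ → ℝ≥0∞) (x : ℝ) :
    stepOp (c * s) μ f x = ENNReal.ofReal c * stepOp s μ f x := by
  unfold stepOp
  rw [mul_assoc c, ENNReal.ofReal_mul hc, mul_assoc]

lemma stepOp_tsum (s μ : ℝ) {f : ℕ → ℝ → ℝ≥0∞} (hf : ∀ n, Measurable (f n)) (x : ℝ) :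
    stepOp s μ (fun y => ∑' n, f n y) x = ∑' n, stepOp s μ (f n) x := by
  unfold stepOp
  rw [ENNReal.tsum_mul_left, ← lintegral_tsum (fun n => by fun_prop)]
  congr 2
  ext w
  rw [ENNReal.tsum_mul_left, ← lintegral_tsum (fun n => by have := hf n; fun_prop)]
  simp only [ENNReal.tsum_mul_left]

lemma greenPotential_eq (s μ : ℝ) {f : ℝ → ℝ≥0∞} (hf : Measurable f) (x : ℝ) :
    f x + stepOp s μ (greenPotential s μ f) x = greenPotential s μ f x := by
  have h : stepOp s μ (greenPotential s μ f) x = ∑' n, (stepOp s μ)^[n + 1] f x := by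
    simp only [Function.iterate_succ_apply']
    exact stepOp_tsum s μ (fun n => measurable_iterate_stepOp s μ hf n) x
  rw [h]
  exact (tsum_eq_zero_add' (f := fun n => (stepOp s μ)^[n] f x) ENNReal.summable).symm

lemma iterate_stepOp_mono {s μ : ℝ} {f g : ℝ → ℝ≥0∞} (h : ∀ x, 1 ≤ x → f x ≤ g x) (n : ℕ) {x : ℝ}
    (hx : 1 ≤ x) : (stepOp s μ)^[n] f x ≤ (stepOp s μ)^[n] g x := by
  induction n generalizing x with
  | zero => exact h x hx
  | succ n ih =>
    simp only [Function.iterate_succ_apply']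
    exact stepOp_mono (fun y hy => ih hy) x

lemma iterate_stepOp_add (s μ : ℝ) {f : ℝ → ℝ≥0∞} (hf : Measurable f) (g : ℝ → ℝ≥0∞) (n : ℕ) :
    (stepOp s μ)^[n] (fun y => f y + g y) =
      fun x => (stepOp s μ)^[n] f x + (stepOp s μ)^[n] g x := by
  induction n with
  | zero => rfl
  | succ n ih =>
    ext x
    simp only [Function.iterate_succ_apply', ih]
    exact stepOp_add s μ (measurable_iterate_stepOp s μ hf n) _ x

lemma sum_iterate_stepOp_add_le {s μ : ℝ} {f g : ℝ → ℝ≥0∞} (hf : Measurable f)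
    (h : ∀ x, 1 ≤ x → f x + stepOp s μ g x ≤ g x) (n : ℕ) {x : ℝ} (hx : 1 ≤ x) :
    ∑ k ∈ Finset.range n, (stepOp s μ)^[k] f x + (stepOp s μ)^[n] g x ≤ g x := by
  induction n with
  | zero => simp
  | succ n ih =>
    refine le_trans ?_ ih
    rw [Finset.sum_range_succ, add_assoc]
    gcongr
    have := iterate_stepOp_mono (s := s) (μ := μ) h n hx
    rwa [iterate_stepOp_add s μ hf] at this

lemma le_sum_iterate_stepOp_add {s μ : ℝ} {f g : ℝ → ℝ≥0∞} (hf : Measurable f)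
    (h : ∀ x, 1 ≤ x → g x ≤ f x + stepOp s μ g x) (n : ℕ) {x : ℝ} (hx : 1 ≤ x) :
    g x ≤ ∑ k ∈ Finset.range n, (stepOp s μ)^[k] f x + (stepOp s μ)^[n] g x := by
  induction n with
  | zero => simp
  | succ n ih =>
    refine le_trans ih ?_
    rw [Finset.sum_range_succ, add_assoc]
    gcongr
    have := iterate_stepOp_mono (s := s) (μ := μ) h n hx
    rwa [iterate_stepOp_add s μ hf] at this

/-- The Green potential is the least supersolution. -/
lemma greenPotential_le {s μ : ℝ} {f g : ℝ → ℝ≥0∞} (hf : Measurable f)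
    (h : ∀ x, 1 ≤ x → f x + stepOp s μ g x ≤ g x) {x : ℝ} (hx : 1 ≤ x) :
    greenPotential s μ f x ≤ g x := by
  refine ENNReal.tsum_le_of_sum_range_le fun n => ?_
  exact le_self_add.trans (sum_iterate_stepOp_add_le hf h n hx)

/-- If the step operator contracts `g` strictly, a solution of the fixed-point equation that is
dominated by a multiple of `g` is the Green potential: the remainder `Kⁿ u` tends to `0`. -/
lemma greenPotential_eq_of_contraction {s μ : ℝ} {f u g : ℝ → ℝ≥0∞} {q : ℝ} {M : ℝ≥0∞}
    (hf : Measurable f) (hg : Measurable g) (h : ∀ x, 1 ≤ x → f x + stepOp s μ u x = u x)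
    (hq : q < 1) (hM : M ≠ ⊤) (hgtop : ∀ x, 1 ≤ x → g x ≠ ⊤)
    (hc : ∀ x, 1 ≤ x → stepOp s μ g x ≤ ENNReal.ofReal q * g x)
    (hu : ∀ x, 1 ≤ x → u x ≤ M * g x) {x : ℝ} (hx : 1 ≤ x) :
    greenPotential s μ f x = u x := by
  refine le_antisymm (greenPotential_le hf (fun x hx => (h x hx).le) hx) ?_
  have hit : ∀ n x, 1 ≤ x → (stepOp s μ)^[n] u x ≤ ENNReal.ofReal q ^ n * (M * g x) := by
    intro n
    induction n with
    | zero => intro x hx; simpa using hu x hx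
    | succ n ih =>
      intro x hx
      rw [Function.iterate_succ_apply']
      calc stepOp s μ ((stepOp s μ)^[n] u) x
          ≤ stepOp s μ (fun y => ENNReal.ofReal q ^ n * (M * g y)) x := stepOp_mono ih x
        _ = ENNReal.ofReal q ^ n * (M * stepOp s μ g x) := by
            rw [stepOp_const_mul _ _ _ (by fun_prop), stepOp_const_mul _ _ _ hg]
        _ ≤ ENNReal.ofReal q ^ n * (M * (ENNReal.ofReal q * g x)) := by gcongr; exact hc x hx
        _ = _ := by ring
  have hlim : Tendsto (fun n : ℕ => greenPotential s μ f x + ENNReal.ofReal q ^ n * (M * g x)) atTop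
      (𝓝 (greenPotential s μ f x)) := by
    have h1 := ENNReal.tendsto_pow_atTop_nhds_zero_of_lt_one (ENNReal.ofReal_lt_one.2 hq)
    have h2 := ENNReal.Tendsto.mul_const (b := M * g x) h1
      (Or.inr (ENNReal.mul_ne_top hM (hgtop x hx)))
    simpa using h2.const_add (greenPotential s μ f x)
  refine ge_of_tendsto' hlim fun n => ?_
  refine (le_sum_iterate_stepOp_add hf (fun x hx => (h x hx).ge) n hx).trans ?_
  gcongr
  · exact ENNReal.sum_le_tsum _
  · exact hit n x hx

/-! ### Power functions as Lyapunov functions -/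

lemma setLIntegral_exp_mul_le {p x A : ℝ} (hA : 0 ≤ A)
    (h : ∀ w, x ≤ w → w ^ p ≤ A * Real.exp ((w - x) / 2)) :
    ∫⁻ w in Ioi x, ENNReal.ofReal (Real.exp (-w) * w ^ p) ≤
      ENNReal.ofReal (2 * A * Real.exp (-x)) := by
  have hint : IntegrableOn (fun w => A * Real.exp (-x / 2) * Real.exp (-(1 / 2) * w)) (Ioi x) :=
    (integrableOn_exp_mul_Ioi (by norm_num) x).const_mul _
  calc ∫⁻ w in Ioi x, ENNReal.ofReal (Real.exp (-w) * w ^ p)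
      ≤ ∫⁻ w in Ioi x, ENNReal.ofReal (A * Real.exp (-x / 2) * Real.exp (-(1 / 2) * w)) := by
        refine setLIntegral_mono' measurableSet_Ioi fun w hw => ENNReal.ofReal_le_ofReal ?_
        calc Real.exp (-w) * w ^ p ≤ Real.exp (-w) * (A * Real.exp ((w - x) / 2)) := by
              gcongr; exact h w (le_of_lt hw)
          _ = A * (Real.exp (-w) * Real.exp ((w - x) / 2)) := by ring
          _ = A * (Real.exp (-x / 2) * Real.exp (-(1 / 2) * w)) := by
              rw [← Real.exp_add, ← Real.exp_add]; ring_nf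
          _ = _ := by ring
    _ = ENNReal.ofReal (∫ w in Ioi x, A * Real.exp (-x / 2) * Real.exp (-(1 / 2) * w)) :=
        (ofReal_integral_eq_lintegral_ofReal hint
          (Eventually.of_forall fun w => by positivity)).symm
    _ = _ := by
        rw [integral_const_mul, integral_exp_mul_Ioi (by norm_num) x]
        congr 1
        have : Real.exp (-x) = Real.exp (-x / 2) * Real.exp (-(1 / 2) * x) := by
          rw [← Real.exp_add]; ring_nf
        rw [this]; ring

lemma setLIntegral_rpow_le {p μ w : ℝ} (hp : μ ≤ p) (hw : 1 ≤ w) :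
    ∫⁻ v in Ioc 1 w, ENNReal.ofReal (v ^ (-μ)) * ENNReal.ofReal (v ^ p) ≤
      ENNReal.ofReal (w ^ (p - μ + 1) / (p - μ + 1)) := by
  have hcont : ContinuousOn (fun v : ℝ => v ^ (p - μ)) (Icc 1 w) := fun v hv =>
    (Real.continuousAt_rpow_const v _ (Or.inl (by linarith [hv.1]))).continuousWithinAt
  calc ∫⁻ v in Ioc 1 w, ENNReal.ofReal (v ^ (-μ)) * ENNReal.ofReal (v ^ p)
      = ∫⁻ v in Ioc 1 w, ENNReal.ofReal (v ^ (p - μ)) := by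
        refine setLIntegral_congr_fun measurableSet_Ioc fun v hv => ?_
        have hv0 : (0 : ℝ) < v := lt_trans one_pos hv.1
        rw [← ENNReal.ofReal_mul (by positivity), ← Real.rpow_add hv0]; ring_nf
    _ = ENNReal.ofReal (∫ v in Ioc 1 w, v ^ (p - μ)) := by
        refine (ofReal_integral_eq_lintegral_ofReal ?_ ?_).symm
        · exact (hcont.integrableOn_Icc).mono_set Ioc_subset_Icc_self
        · refine (ae_restrict_mem measurableSet_Ioc).mono fun v hv => ?_
          have hv0 : (0 : ℝ) < v := lt_trans one_pos hv.1
          simp only [Pi.zero_apply]; positivity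
    _ ≤ _ := by
        refine ENNReal.ofReal_le_ofReal ?_
        rw [← intervalIntegral.integral_of_le hw, integral_rpow (Or.inl (by linarith)),
          Real.one_rpow]
        have : 0 < p - μ + 1 := by linarith
        gcongr
        linarith

/-- The step operator on a power function, in terms of a bound for the growth of the power. -/
lemma stepOp_rpow_le {s μ p x A : ℝ} (hs : 0 ≤ s) (hp : μ ≤ p) (hx : 1 ≤ x) (hA : 0 ≤ A)
    (h : ∀ w, x ≤ w → w ^ p ≤ A * Real.exp ((w - x) / 2)) :
    stepOp s μ (fun v => ENNReal.ofReal (v ^ p)) x ≤ ENNReal.ofReal (2 * s / (p - μ + 1) * A) := by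
  have hp1 : 0 < p - μ + 1 := by linarith
  calc stepOp s μ (fun v => ENNReal.ofReal (v ^ p)) x
      ≤ ENNReal.ofReal (s * Real.exp x) * ∫⁻ w in Ioi x,
          ENNReal.ofReal (p - μ + 1)⁻¹ * ENNReal.ofReal (Real.exp (-w) * w ^ p) := by
        unfold stepOp
        gcongr 1
        refine setLIntegral_mono' measurableSet_Ioi fun w hw => ?_
        have hw1 : 1 ≤ w := le_trans hx (le_of_lt hw)
        have hw0 : 0 < w := by linarith
        refine (mul_le_mul_right (setLIntegral_rpow_le hp hw1) _).trans ?_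
        rw [← ENNReal.ofReal_mul (tiltedWeight_pos μ hw0).le, ← ENNReal.ofReal_mul (by positivity)]
        refine ENNReal.ofReal_le_ofReal (le_of_eq ?_)
        have : w ^ p = w ^ (μ - 1) * w ^ (p - μ + 1) := by rw [← Real.rpow_add hw0]; ring_nf
        rw [tiltedWeight, this]; field_simp
    _ ≤ ENNReal.ofReal (s * Real.exp x) *
          (ENNReal.ofReal (p - μ + 1)⁻¹ * ENNReal.ofReal (2 * A * Real.exp (-x))) := by
        rw [lintegral_const_mul _ (by fun_prop)]
        gcongr
        exact setLIntegral_exp_mul_le hA h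
    _ = _ := by
        rw [← ENNReal.ofReal_mul (by positivity), ← ENNReal.ofReal_mul (by positivity)]
        congr 1
        have : Real.exp x * Real.exp (-x) = 1 := by rw [← Real.exp_add]; simp
        field_simp
        linear_combination (s * A) * this

lemma rpow_le_of_two_mul_le {p x w : ℝ} (hp : 0 ≤ p) (hx : 1 ≤ x) (h2 : 2 * p ≤ x) (hw : x ≤ w) :
    w ^ p ≤ x ^ p * Real.exp ((w - x) / 2) := by
  have hx0 : 0 < x := by linarith
  have hy : 0 ≤ (w - x) / x := div_nonneg (by linarith) hx0.le
  have h1 : w = x * (1 + (w - x) / x) := by field_simp; ring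
  calc w ^ p = x ^ p * (1 + (w - x) / x) ^ p := by
        conv_lhs => rw [h1]
        rw [Real.mul_rpow hx0.le (by linarith)]
    _ ≤ x ^ p * Real.exp ((w - x) / x) ^ p := by
        gcongr; linarith [Real.add_one_le_exp ((w - x) / x)]
    _ ≤ _ := by
        rw [← Real.exp_mul]
        gcongr
        rw [div_mul_eq_mul_div, div_le_div_iff₀ hx0 two_pos]
        nlinarith

lemma exists_rpow_le {p : ℝ} (hp : 0 ≤ p) :
    ∃ C : ℝ, 0 < C ∧ ∀ x w : ℝ, 1 ≤ x → x ≤ w → w ^ p ≤ C * x ^ p * Real.exp ((w - x) / 2) := by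
  obtain ⟨C, hC, h⟩ := exists_one_add_rpow_le p (half_pos one_pos)
  refine ⟨C, hC, fun x w hx hw => ?_⟩
  have hx0 : 0 < x := by linarith
  calc w ^ p ≤ (x * (1 + (w - x))) ^ p := by
        gcongr
        · linarith
        · nlinarith
    _ = x ^ p * (1 + (w - x)) ^ p := Real.mul_rpow hx0.le (by linarith)
    _ ≤ x ^ p * (C * Real.exp (1 / 2 * (w - x))) := by gcongr; exact h _ (by linarith)
    _ = _ := by ring_nf

lemma exitFn_le {s μ p x A : ℝ} (hs : 0 ≤ s) (hp : μ - 1 ≤ p) (hx : 1 ≤ x) (hA : 0 ≤ A)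
    (h : ∀ w, x ≤ w → w ^ p ≤ A * Real.exp ((w - x) / 2)) :
    exitFn s μ x ≤ ENNReal.ofReal (2 * s * A) := by
  calc exitFn s μ x ≤ ENNReal.ofReal (s * Real.exp x) *
          ENNReal.ofReal (2 * A * Real.exp (-x)) := by
        unfold exitFn
        gcongr
        refine le_trans (setLIntegral_mono' measurableSet_Ioi fun w hw => ?_)
          (setLIntegral_exp_mul_le hA h)
        have hw1 : 1 ≤ w := le_trans hx (le_of_lt hw)
        unfold tiltedWeight
        gcongr
    _ = _ := by
        rw [← ENNReal.ofReal_mul (by positivity)]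
        congr 1
        have : Real.exp x * Real.exp (-x) = 1 := by rw [← Real.exp_add]; simp
        linear_combination (2 * s * A) * this

/-- The exponent `p` of the power that serves as a Lyapunov function for `stepOp s μ`. It is chosen
such that `4 * s ≤ p - μ + 1`, which makes the coefficient in `stepOp_rpow_le` at most `1 / 2`. -/
noncomputable def lyapunovExp (s μ : ℝ) : ℝ := |μ| + 4 * s + 1

lemma exists_exitFn_le {s : ℝ} (hs : 0 ≤ s) {p μ : ℝ} (hp : 0 ≤ p) (hμ : μ - 1 ≤ p) :
    ∃ C : ℝ, 0 < C ∧ ∀ x, 1 ≤ x → exitFn s μ x ≤ ENNReal.ofReal (C * x ^ p) := by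
  obtain ⟨C, hC, h⟩ := exists_rpow_le hp
  refine ⟨2 * s * C + 1, by positivity, fun x hx => ?_⟩
  have hx0 : 0 < x := by linarith
  refine (exitFn_le hs hμ hx (by positivity) fun w hw => h x w hx hw).trans
    (ENNReal.ofReal_le_ofReal ?_)
  have : 0 < x ^ p := by positivity
  nlinarith

/-- On a bounded range `exitFn` is bounded away from zero. -/
lemma exists_le_exitFn {s : ℝ} (hs : 0 < s) (μ : ℝ) {X : ℝ} (hX : 1 ≤ X) :
    ∃ c : ℝ≥0∞, c ≠ 0 ∧ ∀ x, 0 ≤ x → x ≤ X → c ≤ exitFn s μ x := by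
  refine ⟨ENNReal.ofReal s * ∫⁻ w in Ioi X, ENNReal.ofReal (tiltedWeight μ w), ?_, ?_⟩
  · refine mul_ne_zero (by simpa using hs) ?_
    rw [← pos_iff_ne_zero, setLIntegral_pos_iff (by fun_prop)]
    have : Ioi X ⊆ Function.support (fun w => ENNReal.ofReal (tiltedWeight μ w)) := by
      intro w hw
      have hw0 : 0 < w := lt_of_lt_of_le one_pos (le_trans hX (le_of_lt hw))
      simpa using tiltedWeight_pos μ hw0
    rw [inter_eq_right.2 this]
    simp
  · intro x hx0 hx
    unfold exitFn
    gcongr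
    exact le_mul_of_one_le_right hs.le (Real.one_le_exp hx0)

/-- A polynomially bounded solution of `u = exitFn s μ + stepOp s μ u` yields a function, comparable
with a power, which the step operator contracts strictly: far out the power itself is contracted,
and a multiple of `u` makes up for the bounded range where it is not. -/
lemma exists_contraction {s μ : ℝ} (hs : 0 < s) {u : ℝ → ℝ≥0∞} (hu : Measurable u) {M : ℝ}
    (hM : 0 ≤ M)
    (h : ∀ x, 1 ≤ x → exitFn s μ x + stepOp s μ u x = u x)
    (hle : ∀ x, 1 ≤ x → u x ≤ ENNReal.ofReal (M * x ^ lyapunovExp s μ)) :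
    ∃ (g : ℝ → ℝ≥0∞) (q : ℝ), Measurable g ∧ 0 < q ∧ q < 1 ∧ ∀ x, 1 ≤ x →
      ENNReal.ofReal (x ^ lyapunovExp s μ) ≤ g x ∧ g x ≠ ⊤ ∧
      stepOp s μ g x ≤ ENNReal.ofReal q * g x := by
  set p := lyapunovExp s μ with hp
  have hp1 : 1 ≤ p := by rw [hp, lyapunovExp]; linarith [abs_nonneg μ]
  have hpμ : 4 * s ≤ p - μ + 1 := by rw [hp, lyapunovExp]; linarith [le_abs_self μ]
  have hμp : μ ≤ p := by rw [hp, lyapunovExp]; linarith [le_abs_self μ]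
  obtain ⟨C, hC, hCle⟩ := exists_rpow_le (p := p) (by linarith)
  obtain ⟨c, hc, hcle⟩ := exists_le_exitFn hs μ (X := 2 * p) (by linarith)
  obtain ⟨B, hB⟩ := ENNReal.exists_nat_mul_gt hc
    (ENNReal.ofReal_ne_top (r := C * (2 * p) ^ p))
  have hcoef : 2 * s / (p - μ + 1) ≤ 1 / 2 := by
    rw [div_le_div_iff₀ (by linarith) two_pos]; linarith
  have hcoef0 : 0 ≤ 2 * s / (p - μ + 1) := div_nonneg (by linarith) (by linarith)
  set k : ℝ → ℝ≥0∞ := fun v => ENNReal.ofReal (v ^ p) with hk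
  have hkm : Measurable k := by fun_prop
  have hstep : ∀ x, 1 ≤ x → stepOp s μ (fun y => k y + B * u y) x ≤
      ENNReal.ofReal (x ^ p / 2) + B * u x := by
    intro x hx
    have hx0 : 0 < x := by linarith
    rw [stepOp_add _ _ hkm, stepOp_const_mul _ _ _ hu]
    rcases le_total (2 * p) x with hx2 | hx2
    · gcongr
      · refine (stepOp_rpow_le hs.le hμp hx (by positivity)
          fun w hw => rpow_le_of_two_mul_le (by linarith) hx hx2 hw).trans
          (ENNReal.ofReal_le_ofReal ?_)
        have : 0 < x ^ p := by positivity
        nlinarith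
      · rw [← h x hx]; exact le_add_self
    · calc stepOp s μ k x + B * stepOp s μ u x
          ≤ B * exitFn s μ x + B * stepOp s μ u x := by
            gcongr
            refine (stepOp_rpow_le hs.le hμp hx (by positivity)
              fun w hw => hCle x w hx hw).trans ?_
            refine le_trans ?_ (hB.le.trans (mul_le_mul_right (hcle x hx0.le hx2) _))
            refine ENNReal.ofReal_le_ofReal ?_
            have h1 : x ^ p ≤ (2 * p) ^ p := by gcongr
            have h2 : C * x ^ p ≤ C * (2 * p) ^ p := by gcongr
            have h3 : 0 < C * x ^ p := by positivity
            nlinarith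
        _ = B * u x := by rw [← mul_add, h x hx]
        _ ≤ _ := le_add_self
  have hBM : 0 ≤ B * M := by positivity
  -- `u ≤ M x ^ p` turns the gain `x ^ p / 2` into a fixed proportion of `x ^ p + B * u x`
  refine ⟨fun y => k y + B * u y, 1 - 1 / (2 * (1 + B * M)), by fun_prop, ?_, ?_,
    fun x hx => ⟨le_self_add, ?_, ?_⟩⟩
  · rw [sub_pos, div_lt_one (by positivity)]; linarith
  · rw [sub_lt_self_iff]; positivity
  · exact ENNReal.add_ne_top.2 ⟨ENNReal.ofReal_ne_top, ENNReal.mul_ne_top (by simp)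
      (ne_top_of_le_ne_top ENNReal.ofReal_ne_top (hle x hx))⟩
  · refine (hstep x hx).trans ?_
    have hx0 : 0 < x := by linarith
    have hut : u x ≠ ⊤ := ne_top_of_le_ne_top ENNReal.ofReal_ne_top (hle x hx)
    obtain ⟨v, hv, hv0⟩ : ∃ v : ℝ, u x = ENNReal.ofReal v ∧ 0 ≤ v :=
      ⟨(u x).toReal, (ENNReal.ofReal_toReal hut).symm, ENNReal.toReal_nonneg⟩
    have hxp : 0 < x ^ p := by positivity
    have hvM : v ≤ M * x ^ p := by
      have := hle x hx
      rwa [hv, ENNReal.ofReal_le_ofReal_iff (by positivity)] at this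
    have hq0 : 0 ≤ 1 - 1 / (2 * (1 + B * M)) := by
      rw [sub_nonneg, div_le_one (by positivity)]; linarith
    have hBr : (B : ℝ≥0∞) = ENNReal.ofReal (B : ℝ) := by simp
    change ENNReal.ofReal (x ^ p / 2) + B * u x ≤
      ENNReal.ofReal (1 - 1 / (2 * (1 + B * M))) * (ENNReal.ofReal (x ^ p) + B * u x)
    rw [hv, hBr, ← ENNReal.ofReal_mul (by positivity),
      ← ENNReal.ofReal_add (by positivity) (by positivity),
      ← ENNReal.ofReal_add (by positivity) (by positivity), ← ENNReal.ofReal_mul hq0]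
    refine ENNReal.ofReal_le_ofReal ?_
    have h1 : B * v ≤ B * (M * x ^ p) := by gcongr
    have h2 : (x ^ p + B * v) / (2 * (1 + B * M)) ≤ x ^ p / 2 := by
      rw [div_le_div_iff₀ (by positivity) two_pos]; nlinarith
    have h3 : (1 - 1 / (2 * (1 + B * M))) * (x ^ p + B * v) =
        x ^ p + B * v - (x ^ p + B * v) / (2 * (1 + B * M)) := by ring
    rw [h3]; linarith

/-! ### From Kummer's equation to the Green potential -/

/-- Integration of the flux equation `J' = -(tiltedWeight μ) φ` over `(x, ∞)`: a flux that vanishes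
at infinity is nonnegative where `φ` is. -/
lemma lintegral_flux {μ : ℝ} {φ J : ℝ → ℝ}
    (hJ : ∀ x, 1 ≤ x → HasDerivAt J (-(tiltedWeight μ x * φ x)) x)
    (hφ : ∀ x, 1 ≤ x → 0 ≤ φ x) (hlim : Tendsto J atTop (𝓝 0)) {x : ℝ} (hx : 1 ≤ x) :
    0 ≤ J x ∧ ∫⁻ w in Ioi x, ENNReal.ofReal (tiltedWeight μ w) * ENNReal.ofReal (φ w) =
      ENNReal.ofReal (J x) := by
  have hd : ∀ w ∈ Ici x, HasDerivAt (fun w => -J w) (tiltedWeight μ w * φ w) w := fun w hw => by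
    simpa using (hJ w (le_trans hx hw)).fun_neg
  have hn : ∀ w ∈ Ioi x, 0 ≤ tiltedWeight μ w * φ w := fun w hw => by
    have hw1 : 1 ≤ w := le_trans hx (le_of_lt hw)
    exact mul_nonneg (tiltedWeight_pos μ (by linarith)).le (hφ w hw1)
  have hl : Tendsto (fun w => -J w) atTop (𝓝 0) := by simpa using hlim.neg
  have hint := integrableOn_Ioi_deriv_of_nonneg' hd hn hl
  have heq := integral_Ioi_of_hasDerivAt_of_nonneg' hd hn hl
  rw [zero_sub, neg_neg] at heq
  refine ⟨heq ▸ setIntegral_nonneg measurableSet_Ioi hn, ?_⟩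
  rw [← heq, ofReal_integral_eq_lintegral_ofReal hint
    ((ae_restrict_mem measurableSet_Ioi).mono hn)]
  refine setLIntegral_congr_fun measurableSet_Ioi fun w hw => ?_
  have hw1 : 1 ≤ w := le_trans hx (le_of_lt hw)
  exact (ENNReal.ofReal_mul (tiltedWeight_pos μ (by linarith)).le).symm

/-- The fundamental theorem of calculus for a nonnegative derivative, in the form of the inner
integral of `stepOp`. -/
lemma ofReal_add_lintegral_deriv {μ : ℝ} {φ ψ : ℝ → ℝ}
    (hφ : ∀ x, 1 ≤ x → HasDerivAt φ (x ^ (-μ) * ψ x) x) (h1 : 0 ≤ φ 1)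
    (hψ : ∀ x, 1 ≤ x → 0 ≤ ψ x) {w : ℝ} (hw : 1 ≤ w) :
    ENNReal.ofReal (φ 1) + ∫⁻ v in Ioc 1 w, ENNReal.ofReal (v ^ (-μ)) * ENNReal.ofReal (ψ v) =
      ENNReal.ofReal (φ w) := by
  have hn : ∀ v ∈ Ioc 1 w, 0 ≤ v ^ (-μ) * ψ v := fun v hv => by
    have hv0 : (0 : ℝ) < v := lt_trans one_pos hv.1
    exact mul_nonneg (by positivity) (hψ v hv.1.le)
  have hint : IntegrableOn (fun v => v ^ (-μ) * ψ v) (Ioc 1 w) :=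
    intervalIntegral.integrableOn_deriv_of_nonneg
      (fun v hv => (hφ v hv.1).continuousAt.continuousWithinAt)
      (fun v hv => hφ v hv.1.le) (fun v hv => hn v ⟨hv.1, hv.2.le⟩)
  have heq := intervalIntegral.integral_eq_sub_of_hasDerivAt (a := 1) (b := w) (f := φ)
    (f' := fun v => v ^ (-μ) * ψ v)
    (fun v hv => hφ v (by rw [uIcc_of_le hw] at hv; exact hv.1))
    ((intervalIntegrable_iff_integrableOn_Ioc_of_le hw).2 hint)
  rw [intervalIntegral.integral_of_le hw] at heq
  have hnn := setIntegral_nonneg (μ := volume) measurableSet_Ioc hn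
  have h2 : ∫⁻ v in Ioc 1 w, ENNReal.ofReal (v ^ (-μ)) * ENNReal.ofReal (ψ v) =
      ENNReal.ofReal (∫ v in Ioc 1 w, v ^ (-μ) * ψ v) := by
    rw [ofReal_integral_eq_lintegral_ofReal hint ((ae_restrict_mem measurableSet_Ioc).mono hn)]
    refine setLIntegral_congr_fun measurableSet_Ioc fun v hv => ?_
    have hv0 : (0 : ℝ) < v := lt_trans one_pos hv.1
    exact (ENNReal.ofReal_mul (by positivity)).symm
  rw [h2, ← ENNReal.ofReal_add h1 hnn, heq]
  congr 1; ring

/-- A nonnegative solution of Kummer's equation with vanishing flux at infinity solves the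
fixed-point equation of the Green potential. -/
lemma IsKummerPair.fixed_point {s μ : ℝ} (hs : 0 < s) {φ J : ℝ → ℝ} (h : IsKummerPair s μ φ J)
    (hφ : ∀ x, 1 ≤ x → 0 < φ x) (hlim : Tendsto J atTop (𝓝 0)) {x : ℝ} (hx : 1 ≤ x) :
    exitFn s μ x + stepOp s μ (fun v => ENNReal.ofReal (s * Real.exp v * J v / φ 1)) x =
      ENNReal.ofReal (s * Real.exp x * J x / φ 1) := by
  have hφ1 := hφ 1 le_rfl
  have hJ := fun x hx => lintegral_flux (μ := μ) (φ := fun x => φ x / φ 1) (J := fun x => J x / φ 1)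
    (fun x hx => ((h.deriv_snd x hx).div_const (φ 1)).congr_deriv (by rw [tiltedWeight]; ring))
    (fun x hx => (div_pos (hφ x hx) hφ1).le) (by simpa using hlim.div_const (φ 1)) (x := x) hx
  have hφ' := fun w hw => ofReal_add_lintegral_deriv (μ := μ) (φ := fun x => φ x / φ 1)
    (ψ := fun x => s * Real.exp x * J x / φ 1)
    (fun x hx => ((h.deriv_fst x hx).div_const (φ 1)).congr_deriv (by ring))
    (div_pos hφ1 hφ1).le (fun x hx => by
      have := (hJ x hx).1
      rw [mul_div_assoc]; positivity) (w := w) hw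
  have e1 : ENNReal.ofReal (s * Real.exp x * J x / φ 1) =
      ENNReal.ofReal (s * Real.exp x) * ENNReal.ofReal (J x / φ 1) := by
    rw [← ENNReal.ofReal_mul (by positivity), mul_div_assoc]
  rw [e1, ← (hJ x hx).2, exitFn, stepOp, ← mul_add, ← lintegral_add_left (by fun_prop)]
  congr 1
  refine setLIntegral_congr_fun measurableSet_Ioi fun w hw => ?_
  have hw1 : 1 ≤ w := le_trans hx (le_of_lt hw)
  have := hφ' w hw1
  rw [div_self hφ1.ne', ENNReal.ofReal_one] at this
  simp only [← this, mul_add, mul_one]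

/-- A finite solution of the fixed-point equation gives a positive solution of Kummer's
equation. -/
lemma exists_isKummerPair_pos {s μ : ℝ} (hs : 0 < s) {V : ℝ → ℝ≥0∞}
    (h : ∀ x, 1 ≤ x → exitFn s μ x + stepOp s μ V x = V x) (hfin : V 1 ≠ ⊤) :
    ∃ G J : ℝ → ℝ, IsKummerPair s μ G J ∧ ∀ x, 1 ≤ x → 0 < G x := by
  set Gt : ℝ → ℝ≥0∞ := fun w => 1 + ∫⁻ v in Ioc 1 w, ENNReal.ofReal (v ^ (-μ)) * V v with hGt
  have hGtm : Measurable Gt := by fun_prop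
  have hGmono : Monotone Gt := fun a b hab => by
    simp only [hGt]; gcongr
  have hVeq : ∀ x, 1 ≤ x → V x = ENNReal.ofReal (s * Real.exp x) *
      ∫⁻ w in Ioi x, ENNReal.ofReal (tiltedWeight μ w) * Gt w := by
    intro x hx
    rw [← h x hx, exitFn, stepOp, ← mul_add, ← lintegral_add_left (by fun_prop)]
    simp only [hGt, mul_add, mul_one]
  have hI : ∫⁻ w in Ioi 1, ENNReal.ofReal (tiltedWeight μ w) * Gt w ≠ ⊤ := by
    intro htop
    apply hfin
    rw [hVeq 1 le_rfl, htop, ENNReal.mul_top]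
    simpa using by positivity
  have hGfin : ∀ w, Gt w ≠ ⊤ := by
    intro w0 htop
    apply hI
    set w1 := max w0 1
    refine top_unique (le_trans ?_ (lintegral_mono_set (Ioi_subset_Ioi (le_max_right w0 1))))
    calc (⊤ : ℝ≥0∞) = ∫⁻ w in Ioi w1, ⊤ := by simp
      _ ≤ _ := by
        refine setLIntegral_mono' measurableSet_Ioi fun w hw => ?_
        have hw1 : 1 ≤ w := le_trans (le_max_right w0 1) (le_of_lt hw)
        have hw0 : w0 ≤ w := le_trans (le_max_left w0 1) (le_of_lt hw)
        have : Gt w = ⊤ := top_unique (htop ▸ hGmono hw0)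
        rw [this, ENNReal.mul_top]
        simpa using tiltedWeight_pos μ (by linarith : 0 < w)
  -- the integrand of the flux, extended by zero to the left of `1`
  set ρ : ℝ → ℝ := (Ioi 1).indicator fun w => tiltedWeight μ w * (Gt w).toReal with hρ
  have hρm : Measurable ρ :=
    (by fun_prop : Measurable fun w => tiltedWeight μ w * (Gt w).toReal).indicator
      measurableSet_Ioi
  have hρ0 : ∀ w, 0 ≤ ρ w := fun w => indicator_nonneg (fun w hw =>
    mul_nonneg (tiltedWeight_pos μ (lt_trans one_pos hw)).le ENNReal.toReal_nonneg) w
  have hρof : ∀ w ∈ Ioi (1:ℝ), ENNReal.ofReal (ρ w) = ENNReal.ofReal (tiltedWeight μ w) * Gt w := by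
    intro w hw
    rw [hρ, indicator_of_mem hw, ENNReal.ofReal_mul (tiltedWeight_pos μ (lt_trans one_pos hw)).le,
      ENNReal.ofReal_toReal (hGfin w)]
  have hρI : Integrable ρ := by
    refine ⟨hρm.aestronglyMeasurable, ?_⟩
    rw [hasFiniteIntegral_iff_ofReal (Eventually.of_forall hρ0)]
    have : (fun w => ENNReal.ofReal (ρ w)) =
        (Ioi 1).indicator fun w => ENNReal.ofReal (tiltedWeight μ w) * Gt w := by
      ext w
      by_cases hw : w ∈ Ioi (1:ℝ)
      · rw [hρof w hw, indicator_of_mem hw]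
      · simp [hρ, indicator_of_notMem hw]
    rw [this, lintegral_indicator measurableSet_Ioi]
    exact hI.lt_top
  set c := ∫ w in Ioi 1, ρ w
  set j : ℝ → ℝ := fun x => c - ∫ w in (1:ℝ)..x, ρ w with hj
  have hjc : Continuous j := continuous_const.sub
    (intervalIntegral.continuous_primitive (fun a b => hρI.intervalIntegrable) 1)
  have hjx : ∀ x, 1 ≤ x → j x = ∫ w in Ioi x, ρ w := by
    intro x hx
    have := intervalIntegral.integral_interval_add_Ioi (a := 1) (b := x) hρI.integrableOn
      hρI.integrableOn
    simp only [hj]; linarith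
  have hj0 : ∀ x, 1 ≤ x → 0 ≤ j x := fun x hx => by
    rw [hjx x hx]; exact integral_nonneg hρ0
  have hVj : ∀ x, 1 ≤ x → V x = ENNReal.ofReal (s * Real.exp x * j x) := by
    intro x hx
    rw [hVeq x hx, ENNReal.ofReal_mul (p := s * Real.exp x) (by positivity), hjx x hx,
      ofReal_integral_eq_lintegral_ofReal hρI.integrableOn (Eventually.of_forall hρ0)]
    congr 1
    exact setLIntegral_congr_fun measurableSet_Ioi fun w hw =>
      (hρof w (lt_of_le_of_lt hx hw)).symm
  set G : ℝ → ℝ := fun w => 1 + ∫ v in (1:ℝ)..w, v ^ (-μ) * (s * Real.exp v * j v) with hG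
  have hcont : ContinuousOn (fun v : ℝ => v ^ (-μ) * (s * Real.exp v * j v)) (Ioi 0) := by
    refine ContinuousOn.mul (fun v hv =>
      (Real.continuousAt_rpow_const v _ (Or.inl (ne_of_gt hv))).continuousWithinAt) ?_
    exact (by fun_prop : Continuous fun v : ℝ => s * Real.exp v * j v).continuousOn
  have huIcc : ∀ w : ℝ, 0 < w → uIcc 1 w ⊆ Ioi 0 := fun w hw v hv => by
    have := hv.1
    exact lt_of_lt_of_le (by rw [lt_inf_iff]; exact ⟨one_pos, hw⟩) this
  have hGd : ∀ w, 0 < w → HasDerivAt G (w ^ (-μ) * (s * Real.exp w * j w)) w := by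
    intro w hw
    exact (intervalIntegral.integral_hasDerivAt_right
      ((hcont.mono (huIcc w hw)).intervalIntegrable)
      (hcont.stronglyMeasurableAtFilter isOpen_Ioi w hw)
      (hcont.continuousAt (isOpen_Ioi.mem_nhds hw))).const_add 1
  have hGcont : ContinuousOn (fun w => tiltedWeight μ w * G w) (Ioi 0) := by
    refine ContinuousOn.mul (ContinuousOn.mul (by fun_prop) fun v hv =>
      (Real.continuousAt_rpow_const v _ (Or.inl (ne_of_gt hv))).continuousWithinAt) ?_
    exact fun w hw => (hGd w hw).continuousAt.continuousWithinAt
  have hG1 : G 1 = 1 := by simp [hG]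
  have hGGt : ∀ w, 1 ≤ w → ENNReal.ofReal (G w) = Gt w := by
    intro w hw
    have := ofReal_add_lintegral_deriv (μ := μ) (φ := G) (ψ := fun v => s * Real.exp v * j v)
      (fun x hx => hGd x (by linarith)) (by rw [hG1]; exact zero_le_one)
      (fun x hx => by have := hj0 x hx; positivity) hw
    rw [← this, hG1, ENNReal.ofReal_one, hGt]
    congr 1
    exact setLIntegral_congr_fun measurableSet_Ioc fun v hv => by rw [hVj v hv.1.le]
  have hGpos : ∀ w, 1 ≤ w → 0 < G w := by
    intro w hw
    have h1 : (1 : ℝ≥0∞) ≤ Gt w := le_self_add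
    rw [← hGGt w hw] at h1
    exact ENNReal.ofReal_pos.1 (lt_of_lt_of_le one_pos h1)
  set J : ℝ → ℝ := fun x => c - ∫ w in (1:ℝ)..x, tiltedWeight μ w * G w with hJ
  have hJj : ∀ x, 1 ≤ x → j x = J x := by
    intro x hx
    simp only [hj, hJ]
    congr 1
    rw [intervalIntegral.integral_of_le hx, intervalIntegral.integral_of_le hx]
    refine setIntegral_congr_fun measurableSet_Ioc fun w hw => ?_
    have hw1 : w ∈ Ioi (1:ℝ) := hw.1
    simp only [hρ, indicator_of_mem hw1]
    rw [← hGGt w hw.1.le, ENNReal.toReal_ofReal (hGpos w hw.1.le).le]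
  refine ⟨G, J, ⟨fun x hx => ?_, fun x hx => ?_⟩, hGpos⟩
  · refine (hGd x (by linarith)).congr_deriv ?_
    rw [hJj x hx]; ring
  · have hx0 : 0 < x := by linarith
    have := (intervalIntegral.integral_hasDerivAt_right
      ((hGcont.mono (huIcc x hx0)).intervalIntegrable)
      (hGcont.stronglyMeasurableAtFilter isOpen_Ioi x hx0)
      (hGcont.continuousAt (isOpen_Ioi.mem_nhds hx0))).const_sub c
    exact this

lemma eventually_tricomiPsi_pos (a b : ℝ) : ∀ᶠ x in atTop, 0 < tricomiPsi a b x := by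
  filter_upwards [(tendsto_rpow_mul_tricomiPsi a b).eventually (lt_mem_nhds one_pos),
    eventually_gt_atTop 0] with x hx hx0
  exact pos_of_mul_pos_right hx (by positivity)

lemma tendsto_rpow_mul_exp_neg (p : ℝ) :
    Tendsto (fun x : ℝ => x ^ p * Real.exp (-x)) atTop (𝓝 0) := by
  simpa using tendsto_rpow_mul_exp_neg_mul_atTop_nhds_zero p 1 one_pos

lemma tendsto_tricomiFlux (s μ : ℝ) : Tendsto (tricomiFlux s μ) atTop (𝓝 0) := by
  have h := (tendsto_rpow_mul_tricomiPsi (1 - s) (1 + μ)).mul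
    (tendsto_rpow_mul_exp_neg (μ - (1 - s)))
  rw [mul_zero] at h
  refine h.congr' ?_
  filter_upwards [eventually_gt_atTop 0] with x hx
  have e : x ^ μ = x ^ (1 - s) * x ^ (μ - (1 - s)) := by rw [← Real.rpow_add hx]; ring_nf
  rw [tricomiFlux, e]
  ring

lemma tendsto_tricomiPsi_sq (s μ : ℝ) :
    Tendsto (fun x => tricomiPsi (-s) μ x ^ 2 * x ^ μ * Real.exp (-x)) atTop (𝓝 0) := by
  have h0 := tendsto_rpow_mul_tricomiPsi (-s) μ
  have h := (h0.mul h0).mul (tendsto_rpow_mul_exp_neg (s + s + μ))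
  rw [mul_zero] at h
  refine h.congr' ?_
  filter_upwards [eventually_gt_atTop 0] with x hx
  rw [Real.rpow_add hx, Real.rpow_add hx, Real.rpow_neg hx.le]
  field_simp

lemma exists_tricomiPsi_le (a b : ℝ) :
    ∃ M : ℝ, 0 < M ∧ ∀ x, 1 ≤ x → tricomiPsi a b x ≤ M * x ^ (-a) := by
  have hcont : ContinuousOn (fun x : ℝ => x ^ a * tricomiPsi a b x) (Ici 1) := fun x hx => by
    have hx0 : (0 : ℝ) < x := lt_of_lt_of_le one_pos hx
    exact ((Real.continuousAt_rpow_const x a (Or.inl hx0.ne')).mul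
      (hasDerivAt_tricomiPsi a b hx0).continuousAt).continuousWithinAt
  obtain ⟨X, hX⟩ := eventually_atTop.1
    ((tendsto_rpow_mul_tricomiPsi a b).eventually (gt_mem_nhds one_lt_two))
  obtain ⟨M, hM⟩ := (isCompact_Icc (a := (1:ℝ)) (b := X)).bddAbove_image
    (hcont.mono Icc_subset_Ici_self)
  refine ⟨max M 2, lt_max_of_lt_right two_pos, fun x hx => ?_⟩
  have hx0 : (0 : ℝ) < x := lt_of_lt_of_le one_pos hx
  have h : x ^ a * tricomiPsi a b x ≤ max M 2 := by
    rcases le_total x X with h | h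
    · exact le_max_of_le_left (hM (mem_image_of_mem _ ⟨hx, h⟩))
    · exact le_max_of_le_right (hX x h).le
  rw [Real.rpow_neg hx0.le, ← div_eq_mul_inv, le_div_iff₀ (by positivity), mul_comm]
  exact h

/-- If the Green potential of `exitFn` is finite at `1`, then the Tricomi solution is positive on
`[1, ∞)`. -/
lemma tricomiPsi_pos_of_greenPotential {s μ : ℝ} (hs : 0 < s)
    (h : greenPotential s μ (exitFn s μ) 1 ≠ ⊤) {x : ℝ} (hx : 1 ≤ x) : 0 < tricomiPsi (-s) μ x := by
  obtain ⟨G, J, hG, hpos⟩ := exists_isKummerPair_pos hs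
    (fun x _ => greenPotential_eq s μ (measurable_exitFn s μ) x) h
  exact (isKummerPair_tricomi s μ).pos_of_pos hs hG hpos (eventually_tricomiPsi_pos _ _)
    (tendsto_tricomiPsi_sq s μ) hx

/-- The polynomially bounded solution of the fixed-point equation that is built from the Tricomi
function. -/
noncomputable def tricomiSolution (s μ x : ℝ) : ℝ≥0∞ :=
  ENNReal.ofReal (s * Real.exp x * tricomiFlux s μ x / tricomiPsi (-s) μ 1)

lemma exists_tricomiSolution_le {s μ : ℝ} (hs : 0 < s) (h1 : 0 < tricomiPsi (-s) μ 1) :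
    ∃ M : ℝ, 0 ≤ M ∧ ∀ x, 1 ≤ x →
      tricomiSolution s μ x ≤ ENNReal.ofReal (M * x ^ lyapunovExp s μ) := by
  obtain ⟨M, hM, hle⟩ := exists_tricomiPsi_le (1 - s) (1 + μ)
  refine ⟨s * M / tricomiPsi (-s) μ 1, by positivity, fun x hx => ENNReal.ofReal_le_ofReal ?_⟩
  have hx0 : (0 : ℝ) < x := lt_of_lt_of_le one_pos hx
  rw [div_mul_eq_mul_div]
  refine div_le_div_of_nonneg_right ?_ h1.le
  have e : Real.exp x * Real.exp (-x) = 1 := by rw [← Real.exp_add]; simp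
  calc s * Real.exp x * tricomiFlux s μ x
      = s * x ^ μ * tricomiPsi (1 - s) (1 + μ) x := by
        rw [tricomiFlux]; linear_combination (s * x ^ μ * tricomiPsi (1 - s) (1 + μ) x) * e
    _ ≤ s * x ^ μ * (M * x ^ (-(1 - s))) := by gcongr; exact hle x hx
    _ = s * M * x ^ (μ + -(1 - s)) := by rw [Real.rpow_add hx0]; ring
    _ ≤ s * M * x ^ lyapunovExp s μ := by
        gcongr
        rw [lyapunovExp]; linarith [le_abs_self μ]

/-- A function bounded below by a power that the step operator contracts. -/
lemma exists_contraction_of_greenPotential {s μ : ℝ} (hs : 0 < s)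
    (h : greenPotential s μ (exitFn s μ) 1 ≠ ⊤) :
    ∃ (g : ℝ → ℝ≥0∞) (q : ℝ), Measurable g ∧ 0 < q ∧ q < 1 ∧ ∀ x, 1 ≤ x →
      ENNReal.ofReal (x ^ lyapunovExp s μ) ≤ g x ∧ g x ≠ ⊤ ∧
      stepOp s μ g x ≤ ENNReal.ofReal q * g x := by
  have hpos := fun x (hx : 1 ≤ x) => tricomiPsi_pos_of_greenPotential hs h hx
  obtain ⟨M, hM, hle⟩ := exists_tricomiSolution_le hs (hpos 1 le_rfl)
  have hfix := fun x (hx : 1 ≤ x) =>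
    (isKummerPair_tricomi s μ).fixed_point hs hpos (tendsto_tricomiFlux s μ) hx
  refine exists_contraction hs (measurable_greenPotential s μ (measurable_exitFn s μ)) hM
    (fun x _ => greenPotential_eq s μ (measurable_exitFn s μ) x) fun x hx => ?_
  exact (greenPotential_le (measurable_exitFn s μ) (fun x hx => (hfix x hx).le) hx).trans (hle x hx)

/-- The value of the Green potential where it is finite. -/
lemma greenPotential_exitFn {s μ : ℝ} (hs : 0 < s)
    (h : greenPotential s μ (exitFn s μ) 1 ≠ ⊤) :
    greenPotential s μ (exitFn s μ) 1 =
      ENNReal.ofReal (s * (tricomiPsi (1 - s) (1 + μ) 1 / tricomiPsi (-s) μ 1)) ∧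
    0 ≤ s * (tricomiPsi (1 - s) (1 + μ) 1 / tricomiPsi (-s) μ 1) := by
  have hpos := fun x (hx : 1 ≤ x) => tricomiPsi_pos_of_greenPotential hs h hx
  obtain ⟨g, q, hg, hq0, hq1, hgq⟩ := exists_contraction_of_greenPotential hs h
  obtain ⟨M, hM, hle⟩ := exists_tricomiSolution_le hs (hpos 1 le_rfl)
  have hfix := fun x (hx : 1 ≤ x) =>
    (isKummerPair_tricomi s μ).fixed_point hs hpos (tendsto_tricomiFlux s μ) hx
  have hflux := fun x (hx : 1 ≤ x) => (lintegral_flux (μ := μ) (φ := tricomiPsi (-s) μ)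
    (J := tricomiFlux s μ) (isKummerPair_tricomi s μ).deriv_snd (fun x hx => (hpos x hx).le)
    (tendsto_tricomiFlux s μ) hx).1
  have e : Real.exp 1 * Real.exp (-1) = 1 := by rw [← Real.exp_add]; simp
  have heq : s * Real.exp 1 * tricomiFlux s μ 1 / tricomiPsi (-s) μ 1 =
      s * (tricomiPsi (1 - s) (1 + μ) 1 / tricomiPsi (-s) μ 1) := by
    rw [tricomiFlux, Real.one_rpow]
    linear_combination (s * tricomiPsi (1 - s) (1 + μ) 1 / tricomiPsi (-s) μ 1) * e
  refine ⟨?_, ?_⟩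
  · rw [← heq]
    refine greenPotential_eq_of_contraction (u := tricomiSolution s μ) (M := ENNReal.ofReal M)
      (measurable_exitFn s μ) hg hfix hq1 ENNReal.ofReal_ne_top (fun x hx => (hgq x hx).2.1)
      (fun x hx => (hgq x hx).2.2) (fun x hx => (hle x hx).trans ?_) le_rfl
    rw [ENNReal.ofReal_mul hM]
    gcongr
    exact (hgq x hx).1
  · rw [← heq]
    have := hflux 1 le_rfl
    have := hpos 1 le_rfl
    positivity

/-- Finiteness persists for a slightly larger `s`. -/
lemma exists_greenPotential_ne_top_of_lt {s μ : ℝ} (hs : 0 < s)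
    (h : greenPotential s μ (exitFn s μ) 1 ≠ ⊤) :
    ∃ s' > s, greenPotential s' μ (exitFn s' μ) 1 ≠ ⊤ := by
  obtain ⟨g, q, hg, hq0, hq1, hgq⟩ := exists_contraction_of_greenPotential hs h
  -- any `c > 1` with `c * q < 1` will do
  set c := 2 / (1 + q) with hc
  have hc1 : 1 < c := by rw [hc, one_lt_div (by linarith)]; linarith
  have hcq : c * q < 1 := by rw [hc, div_mul_eq_mul_div, div_lt_one (by linarith)]; linarith
  have hcs : s < c * s := by nlinarith
  have hp : 0 ≤ lyapunovExp s μ := by rw [lyapunovExp]; positivity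
  obtain ⟨C, hC, hCle⟩ := exists_exitFn_le (s := c * s) (by linarith) (μ := μ) hp
    (by rw [lyapunovExp]; linarith [le_abs_self μ])
  -- the multiple of `g` that is a supersolution for `c * s`: `C + c * q * B = B`
  set B := C / (1 - c * q) with hB
  have hB0 : 0 < B := div_pos hC (by linarith)
  have hBeq : C + c * q * B = B := by
    have : 1 - c * q ≠ 0 := by linarith
    rw [hB]; field_simp; ring
  refine ⟨c * s, hcs, ne_top_of_le_ne_top (b := ENNReal.ofReal B * g 1)
    (ENNReal.mul_ne_top ENNReal.ofReal_ne_top (hgq 1 le_rfl).2.1) ?_⟩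
  refine greenPotential_le (g := fun x => ENNReal.ofReal B * g x) (measurable_exitFn _ _)
    (fun x hx => ?_) le_rfl
  rw [stepOp_const_mul _ _ _ hg, stepOp_mul_left (by linarith)]
  calc exitFn (c * s) μ x + ENNReal.ofReal B * (ENNReal.ofReal c * stepOp s μ g x)
      ≤ ENNReal.ofReal C * g x +
          ENNReal.ofReal B * (ENNReal.ofReal c * (ENNReal.ofReal q * g x)) := by
        gcongr
        · refine (hCle x hx).trans ?_
          rw [ENNReal.ofReal_mul hC.le]
          gcongr
          exact (hgq x hx).1
        · exact (hgq x hx).2.2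
    _ = ENNReal.ofReal (C + c * q * B) * g x := by
        rw [ENNReal.ofReal_add hC.le (by positivity), ENNReal.ofReal_mul (by positivity),
          ENNReal.ofReal_mul (by positivity)]
        ring
    _ = _ := by rw [hBeq]

/-- For every `μ` the potential is finite for small `s`. -/
lemma exists_greenPotential_ne_top (μ : ℝ) :
    ∃ s > 0, greenPotential s μ (exitFn s μ) 1 ≠ ⊤ := by
  obtain ⟨C, hC, hCle⟩ := exists_rpow_le (p := |μ|) (abs_nonneg μ)
  have hμ := le_abs_self μ
  set s := 1 / (4 * C) with hs
  have hs0 : 0 < s := by positivity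
  refine ⟨s, hs0, ne_top_of_le_ne_top (b := ENNReal.ofReal ((1:ℝ) ^ |μ|)) ENNReal.ofReal_ne_top ?_⟩
  refine greenPotential_le (g := fun x => ENNReal.ofReal (x ^ |μ|)) (measurable_exitFn _ _)
    (fun x hx => ?_) le_rfl
  have hx0 : (0 : ℝ) < x := lt_of_lt_of_le one_pos hx
  have hk := stepOp_rpow_le hs0.le hμ hx (A := C * x ^ |μ|) (by positivity)
    fun w hw => hCle x w hx hw
  have he := exitFn_le (μ := μ) hs0.le (by linarith) hx (A := C * x ^ |μ|) (by positivity)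
    fun w hw => hCle x w hx hw
  refine (add_le_add he hk).trans ?_
  have hcoef : 2 * s / (|μ| - μ + 1) ≤ 2 * s := div_le_self (by positivity) (by linarith)
  have hcoef0 : 0 ≤ 2 * s / (|μ| - μ + 1) := div_nonneg (by positivity) (by linarith)
  rw [← ENNReal.ofReal_add (by positivity) (by positivity)]
  refine ENNReal.ofReal_le_ofReal ?_
  have h1 : 2 * s / (|μ| - μ + 1) * (C * x ^ |μ|) ≤ 2 * s * (C * x ^ |μ|) := by gcongr
  have h2 : 2 * s * (C * x ^ |μ|) + 2 * s * (C * x ^ |μ|) = x ^ |μ| := by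
    rw [hs]; field_simp; ring
  linarith

/-- For `s = 1` and `μ = 0`, Kummer's equation is solved by `φ = x`. -/
lemma greenPotential_exitFn_one_zero : greenPotential 1 0 (exitFn 1 0) 1 ≠ ⊤ := by
  have hpair : IsKummerPair 1 0 (fun x => x) (fun x => Real.exp (-x)) := by
    refine ⟨fun x hx => ?_, fun x hx => ?_⟩
    · refine (hasDerivAt_id' x).congr_deriv ?_
      have e : Real.exp x * Real.exp (-x) = 1 := by rw [← Real.exp_add]; simp
      simpa using e.symm
    · have hx0 : x ≠ 0 := by linarith
      refine (hasDerivAt_neg x).exp.congr_deriv ?_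
      rw [zero_sub, Real.rpow_neg_one]
      field_simp
  have hlim : Tendsto (fun x : ℝ => Real.exp (-x)) atTop (𝓝 0) :=
    Real.tendsto_exp_neg_atTop_nhds_zero
  exact ne_top_of_le_ne_top ENNReal.ofReal_ne_top (greenPotential_le (measurable_exitFn _ _)
    (fun x hx => (hpair.fixed_point one_pos (fun x hx => by linarith) hlim hx).le) le_rfl)

/-- The function `2 + log x` solves `u = 1 + K u`; it is therefore the potential of the constant
`1`, which is the mean killing time. -/
lemma greenPotential_one : greenPotential 1 0 (fun _ => 1) 1 = 2 := by
  obtain ⟨g, q, hg, hq0, hq1, hgq⟩ :=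
    exists_contraction_of_greenPotential one_pos greenPotential_exitFn_one_zero
  have hH : ∀ x : ℝ, 1 ≤ x → HasDerivAt (fun x => x * Real.log x - 1 + x)
      (x ^ (-0 : ℝ) * (2 + Real.log x)) x := by
    intro x hx
    have hx0 : x ≠ 0 := by linarith
    refine ((((hasDerivAt_id' x).mul (Real.hasDerivAt_log hx0)).sub_const 1).add
      (hasDerivAt_id' x)).congr_deriv ?_
    simp only [neg_zero, Real.rpow_zero]
    field_simp
    ring
  have hJ : ∀ x : ℝ, 1 ≤ x → HasDerivAt (fun x => Real.exp (-x) * (1 + Real.log x))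
      (-(tiltedWeight 0 x * (x * Real.log x - 1 + x))) x := by
    intro x hx
    have hx0 : x ≠ 0 := by linarith
    refine ((hasDerivAt_neg x).exp.mul ((Real.hasDerivAt_log hx0).const_add 1)).congr_deriv ?_
    rw [tiltedWeight, zero_sub, Real.rpow_neg_one]
    field_simp
    ring
  have hH0 : ∀ x : ℝ, 1 ≤ x → 0 ≤ x * Real.log x - 1 + x := fun x hx => by
    have := mul_nonneg (by linarith : 0 ≤ x) (Real.log_nonneg hx)
    linarith
  have hlim : Tendsto (fun x => Real.exp (-x) * (1 + Real.log x)) atTop (𝓝 0) := by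
    have h2 := tendsto_rpow_mul_exp_neg 1
    refine tendsto_of_tendsto_of_tendsto_of_le_of_le' tendsto_const_nhds h2 ?_ ?_
    · filter_upwards [eventually_ge_atTop 1] with x hx
      have := Real.log_nonneg hx
      positivity
    · filter_upwards [eventually_ge_atTop 1] with x hx
      rw [Real.rpow_one, mul_comm]
      gcongr
      linarith [Real.log_le_sub_one_of_pos (by linarith : 0 < x)]
  have hsol : ∀ x : ℝ, 1 ≤ x →
      1 + stepOp 1 0 (fun x => ENNReal.ofReal (2 + Real.log x)) x =
        ENNReal.ofReal (2 + Real.log x) := by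
    intro x hx
    have hlog := Real.log_nonneg hx
    have h1 : stepOp 1 0 (fun x => ENNReal.ofReal (2 + Real.log x)) x =
        ENNReal.ofReal (1 + Real.log x) := by
      have e : Real.exp x * Real.exp (-x) = 1 := by rw [← Real.exp_add]; simp
      have e1 : 1 + Real.log x = 1 * Real.exp x * (Real.exp (-x) * (1 + Real.log x)) := by
        linear_combination (-(1 + Real.log x)) * e
      rw [e1, ENNReal.ofReal_mul (by positivity), ← (lintegral_flux hJ hH0 hlim hx).2, stepOp]
      congr 1
      refine setLIntegral_congr_fun measurableSet_Ioi fun w hw => ?_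
      have hw1 : 1 ≤ w := le_trans hx (le_of_lt hw)
      have := ofReal_add_lintegral_deriv hH (by simp)
        (fun x hx => by have := Real.log_nonneg hx; positivity) hw1
      rw [Real.log_one, mul_zero, zero_sub, neg_add_cancel, ENNReal.ofReal_zero, zero_add] at this
      rw [this]
    rw [h1, ← ENNReal.ofReal_one, ← ENNReal.ofReal_add zero_le_one (by linarith)]
    congr 1; ring
  have := greenPotential_eq_of_contraction (s := 1) (μ := 0)
    (u := fun x => ENNReal.ofReal (2 + Real.log x)) (f := fun _ => 1) (M := ENNReal.ofReal 2)
    measurable_const hg hsol hq1 ENNReal.ofReal_ne_top (fun x hx => (hgq x hx).2.1)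
    (fun x hx => (hgq x hx).2.2) (fun x hx => ?_) le_rfl
  · rw [this]; simp
  · refine le_trans ?_ (mul_le_mul_right (hgq x hx).1 _)
    rw [← ENNReal.ofReal_mul two_pos.le]
    refine ENNReal.ofReal_le_ofReal ?_
    have h1 : x ≤ x ^ lyapunovExp 1 0 := by
      conv_lhs => rw [← Real.rpow_one x]
      exact Real.rpow_le_rpow_of_exponent_le hx (by rw [lyapunovExp]; norm_num)
    linarith [Real.log_le_sub_one_of_pos (by linarith : 0 < x)]

/-! ### Integrals against exponential variables -/

lemma lintegral_expMeasure (f : ℝ → ℝ≥0∞) (hf : Measurable f) :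
    ∫⁻ y, f y ∂(expMeasure 1) = ∫⁻ y in Ioi 0, ENNReal.ofReal (Real.exp (-y)) * f y := by
  have h1 : expMeasure 1 = volume.withDensity (exponentialPDF 1) := rfl
  have hm : Measurable (exponentialPDF 1) := (measurable_exponentialPDFReal 1).ennreal_ofReal
  rw [h1, lintegral_withDensity_eq_lintegral_mul _ hm hf, ← lintegral_indicator measurableSet_Ioi]
  have h0 : ∀ᵐ y : ℝ, y ≠ 0 := by simp [ae_iff]
  refine lintegral_congr_ae (h0.mono fun y hy => ?_)
  simp only [Pi.mul_apply]
  rcases lt_or_gt_of_ne hy with h | h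
  · rw [exponentialPDF_of_neg h, indicator_of_notMem (by simpa using h.le), zero_mul]
  · rw [exponentialPDF_of_nonneg h.le, indicator_of_mem (by simpa using h)]
    simp

/-- The substitution `v = w e ^ (-e)`. -/
lemma lintegral_exp_substitution (μ : ℝ) {w : ℝ} (hw : 0 < w) (g : ℝ → ℝ≥0∞) :
    ∫⁻ e in Ioi 0, ENNReal.ofReal (Real.exp (-e)) *
      (ENNReal.ofReal (Real.exp (μ * e)) * g (w * Real.exp (-e))) =
    ENNReal.ofReal (w ^ (μ - 1)) * ∫⁻ v in Ioo 0 w, ENNReal.ofReal (v ^ (-μ)) * g v := by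
  have himg : (fun e => w * Real.exp (-e)) '' Ioi 0 = Ioo 0 w := by
    ext v
    constructor
    · rintro ⟨e, he, rfl⟩
      have he' : (0 : ℝ) < e := he
      have : Real.exp (-e) < 1 := by simpa using he'
      exact ⟨by positivity, by nlinarith [Real.exp_pos (-e)]⟩
    · rintro ⟨h0, h1⟩
      refine ⟨-Real.log (v / w), ?_, ?_⟩
      · have : Real.log (v / w) < 0 := Real.log_neg (by positivity) ((div_lt_one hw).2 h1)
        simpa using this
      · simp only [neg_neg]
        rw [Real.exp_log (by positivity)]
        field_simp
  have hd : ∀ e ∈ Ioi (0:ℝ), HasDerivWithinAt (fun e => w * Real.exp (-e)) (-(w * Real.exp (-e)))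
      (Ioi 0) e := fun e _ => by
    refine HasDerivAt.hasDerivWithinAt ?_
    refine ((hasDerivAt_neg e).exp.const_mul w).congr_deriv (by ring)
  have hinj : InjOn (fun e => w * Real.exp (-e)) (Ioi 0) := by
    intro a _ b _ hab
    have := Real.exp_injective (mul_left_cancel₀ hw.ne' hab)
    linarith
  rw [← himg, lintegral_image_eq_lintegral_abs_deriv_mul measurableSet_Ioi hd hinj,
    ← lintegral_const_mul' _ _ ENNReal.ofReal_ne_top]
  refine lintegral_congr fun e => ?_
  rw [← mul_assoc, ← mul_assoc, ← mul_assoc, ← ENNReal.ofReal_mul (by positivity),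
    ← ENNReal.ofReal_mul (by positivity), ← ENNReal.ofReal_mul (by positivity)]
  congr 2
  rw [abs_neg, abs_of_pos (by positivity), Real.mul_rpow hw.le (Real.exp_pos _).le, ← Real.exp_mul,
    Real.rpow_sub_one hw.ne', Real.rpow_neg hw.le, show -e * -μ = μ * e by ring]
  have := (Real.rpow_pos_of_pos hw μ).ne'
  field_simp

/-- One step of the chain from `x`, in the variables `w = x + y` and `v = w e ^ (-e)`. -/
lemma lintegral_step (μ : ℝ) {x : ℝ} (hx : 0 < x) {g : ℝ → ℝ≥0∞} (hg : Measurable g) :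
    ∫⁻ p, ENNReal.ofReal (Real.exp (μ * p.2)) * g ((x + p.1) * Real.exp (-p.2))
        ∂((expMeasure 1).prod (expMeasure 1)) =
      ENNReal.ofReal (Real.exp x) * ∫⁻ w in Ioi x, ENNReal.ofReal (tiltedWeight μ w) *
        ∫⁻ v in Ioo 0 w, ENNReal.ofReal (v ^ (-μ)) * g v := by
  have : IsProbabilityMeasure (expMeasure 1) := isProbabilityMeasure_expMeasure one_pos
  rw [lintegral_prod _ (by fun_prop)]
  have hin : Measurable fun y : ℝ => ∫⁻ e, ENNReal.ofReal (Real.exp (μ * e)) *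
      g ((x + y) * Real.exp (-e)) ∂(expMeasure 1) :=
    Measurable.lintegral_prod_right' (f := fun p : ℝ × ℝ => ENNReal.ofReal (Real.exp (μ * p.2)) *
      g ((x + p.1) * Real.exp (-p.2))) (by fun_prop)
  rw [lintegral_expMeasure _ hin, ← lintegral_const_mul' _ _ ENNReal.ofReal_ne_top]
  have hpre : Ioi (0:ℝ) = (fun y => x + y) ⁻¹' Ioi x := by ext y; simp
  have htr := (measurePreserving_add_left volume x).setLIntegral_comp_preimage_emb
    (measurableEmbedding_addLeft x) (fun w => ENNReal.ofReal (Real.exp x) *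
      (ENNReal.ofReal (tiltedWeight μ w) *
        ∫⁻ v in Ioo 0 w, ENNReal.ofReal (v ^ (-μ)) * g v)) (Ioi x)
  rw [← htr, ← hpre]
  refine setLIntegral_congr_fun measurableSet_Ioi fun y hy => ?_
  have hy' : (0 : ℝ) < y := hy
  rw [lintegral_expMeasure _ (by fun_prop), lintegral_exp_substitution μ (by positivity) g,
    ← mul_assoc, ← mul_assoc, ← ENNReal.ofReal_mul (by positivity),
    ← ENNReal.ofReal_mul (by positivity)]
  congr 2
  rw [tiltedWeight, ← mul_assoc, ← Real.exp_add]
  ring_nf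

lemma lintegral_step_alive {s : ℝ} (hs : 0 ≤ s) (μ : ℝ) {x : ℝ} (hx : 1 ≤ x) {f : ℝ → ℝ≥0∞}
    (hf : Measurable f) :
    ENNReal.ofReal s * ∫⁻ p, ENNReal.ofReal (Real.exp (μ * p.2)) *
        (Ici 1).indicator f ((x + p.1) * Real.exp (-p.2))
        ∂((expMeasure 1).prod (expMeasure 1)) = stepOp s μ f x := by
  rw [lintegral_step μ (by linarith) (hf.indicator measurableSet_Ici), ← mul_assoc,
    ← ENNReal.ofReal_mul hs, stepOp]
  congr 1
  refine setLIntegral_congr_fun measurableSet_Ioi fun w hw => ?_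
  have hw1 : 1 < w := lt_of_le_of_lt hx hw
  congr 1
  have h1 : ∀ v, ENNReal.ofReal (v ^ (-μ)) * (Ici 1).indicator f v =
      (Ici 1).indicator (fun v => ENNReal.ofReal (v ^ (-μ)) * f v) v := fun v => by
    by_cases hv : v ∈ Ici (1:ℝ)
    · rw [indicator_of_mem hv, indicator_of_mem hv]
    · rw [indicator_of_notMem hv, indicator_of_notMem hv, mul_zero]
  simp only [h1]
  rw [setLIntegral_indicator measurableSet_Ici]
  have h2 : Ici 1 ∩ Ioo 0 w = Ico 1 w := by
    ext v; simp only [mem_inter_iff, mem_Ici, mem_Ioo, mem_Ico]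
    constructor
    · rintro ⟨a, b, c⟩; exact ⟨a, c⟩
    · rintro ⟨a, c⟩; exact ⟨a, by linarith, c⟩
  rw [h2, setLIntegral_congr Ico_ae_eq_Ioc]

lemma lintegral_step_exit {s : ℝ} (hs : 0 ≤ s) (μ : ℝ) {x : ℝ} (hx : 1 ≤ x) :
    ENNReal.ofReal s * ∫⁻ p, ENNReal.ofReal (Real.exp (μ * p.2)) *
        (Iio 1).indicator (fun v => ENNReal.ofReal (v ^ μ)) ((x + p.1) * Real.exp (-p.2))
        ∂((expMeasure 1).prod (expMeasure 1)) = exitFn s μ x := by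
  rw [lintegral_step μ (by linarith) ((by fun_prop : Measurable _).indicator measurableSet_Iio),
    ← mul_assoc, ← ENNReal.ofReal_mul hs, exitFn]
  congr 1
  refine setLIntegral_congr_fun measurableSet_Ioi fun w hw => ?_
  have hw1 : 1 < w := lt_of_le_of_lt hx hw
  have h1 : ∫⁻ v in Ioo 0 w, ENNReal.ofReal (v ^ (-μ)) *
      (Iio 1).indicator (fun v => ENNReal.ofReal (v ^ μ)) v =
      ∫⁻ v in Ioo 0 w, (Iio 1).indicator (fun _ => 1) v := by
    refine setLIntegral_congr_fun measurableSet_Ioo fun v hv => ?_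
    by_cases hv1 : v ∈ Iio (1:ℝ)
    · simp only [indicator_of_mem hv1]
      rw [← ENNReal.ofReal_mul (Real.rpow_nonneg hv.1.le _), ← Real.rpow_add hv.1]
      simp
    · simp only [indicator_of_notMem hv1, mul_zero]
  have h2 : Iio 1 ∩ Ioo 0 w = Ioo 0 1 := by
    ext v; simp only [mem_inter_iff, mem_Iio, mem_Ioo]
    constructor
    · rintro ⟨a, b, c⟩; exact ⟨b, a⟩
    · rintro ⟨a, c⟩; exact ⟨c, a, by linarith⟩
  rw [h1, setLIntegral_indicator measurableSet_Iio, h2]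
  simp

/-! ### Independence of a step from the past -/

section Cluster

variable {Ω : Type*}

lemma measurable_points [MeasurableSpace Ω] {t : ℕ → Ω → ℝ} (h0 : ∀ ω, t 0 ω = 0) {k : ℕ}
    (hgap : ∀ j < k, Measurable fun ω => t (j + 1) ω - t j ω) :
    ∀ j ≤ k, Measurable (t j) := by
  intro j
  induction j with
  | zero => intro _; rw [show t 0 = fun _ => 0 from funext h0]; exact measurable_const
  | succ j ih =>
    intro hj
    have e : t (j + 1) = fun ω => t j ω + (t (j + 1) ω - t j ω) := by ext ω; ring
    rw [e]
    exact (ih (by omega)).add (hgap j (by omega))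

lemma measurable_clusterZ [MeasurableSpace Ω] {t Y : ℕ → Ω → ℝ} {k : ℕ}
    (ht : ∀ j ≤ k, Measurable (t j)) (hY : ∀ j < k, Measurable (Y j)) :
    ∀ j ≤ k, Measurable (clusterZ t Y j) := by
  intro j
  induction j with
  | zero => intro _; exact measurable_const
  | succ j ih =>
    intro hj
    exact (ih (by omega)).add ((hY j (by omega)).mul (Real.measurable_exp.comp (ht j (by omega))))

/-- The event that the cluster contains the points `t 0, …, t k`. -/
def aliveSet (t Y : ℕ → Ω → ℝ) (k : ℕ) : Set Ω :=
  {ω | ∀ j ≤ k, t j ω ≤ Real.log (clusterZ t Y j ω)}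

lemma measurableSet_aliveSet [MeasurableSpace Ω] {t Y : ℕ → Ω → ℝ} {k : ℕ}
    (ht : ∀ j ≤ k, Measurable (t j)) (hY : ∀ j < k, Measurable (Y j)) :
    MeasurableSet (aliveSet t Y k) := by
  have : aliveSet t Y k = ⋂ j, ⋂ _ : j ≤ k, {ω | t j ω ≤ Real.log (clusterZ t Y j ω)} := by
    ext ω; simp [aliveSet]
  rw [this]
  exact MeasurableSet.iInter fun j => MeasurableSet.iInter fun hj =>
    measurableSet_le (ht j hj) (Real.measurable_log.comp (measurable_clusterZ ht hY j hj))

/-- The variables `Y k` together with the gaps of `t`. -/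
def inputFamily (t Y : ℕ → Ω → ℝ) : ℕ ⊕ ℕ → Ω → ℝ :=
  Sum.elim Y fun k ω => t (k + 1) ω - t k ω

/-- The σ-algebra of the first `k` steps. -/
@[reducible]
def pastSigma (t Y : ℕ → Ω → ℝ) (k : ℕ) : MeasurableSpace Ω :=
  ⨆ i ∈ {i : ℕ ⊕ ℕ | Sum.elim id id i < k}, MeasurableSpace.comap (inputFamily t Y i) inferInstance

lemma measurable_past_inputFamily (t Y : ℕ → Ω → ℝ) {k : ℕ} {i : ℕ ⊕ ℕ}
    (hi : Sum.elim id id i < k) : Measurable[pastSigma t Y k] (inputFamily t Y i) :=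
  measurable_iff_comap_le.2
    (le_iSup₂_of_le (f := fun i (_ : i ∈ {i : ℕ ⊕ ℕ | Sum.elim id id i < k}) =>
      MeasurableSpace.comap (inputFamily t Y i) inferInstance) i hi le_rfl)

variable [MeasurableSpace Ω] {P : Measure Ω} {t Y : ℕ → Ω → ℝ}

lemma IsClusterInput.measurable_inputFamily (h : IsClusterInput t Y P) (i : ℕ ⊕ ℕ) :
    Measurable (inputFamily t Y i) := by
  cases i with
  | inl k => exact h.measurable k
  | inr k => exact (h.poisson.measurable (k + 1)).sub (h.poisson.measurable k)

lemma IsClusterInput.iIndepFun_inputFamily (h : IsClusterInput t Y P) :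
    iIndepFun (inputFamily t Y) P := by
  rw [iIndepFun_iff_measure_inter_preimage_eq_mul]
  intro S sets hS
  have hL : ∀ i ∈ S.toLeft, MeasurableSet (sets (Sum.inl i)) := fun i hi =>
    hS _ (Finset.mem_toLeft.1 hi)
  have hR : ∀ i ∈ S.toRight, MeasurableSet (sets (Sum.inr i)) := fun i hi =>
    hS _ (Finset.mem_toRight.1 hi)
  have e1 := (iIndepFun_iff_measure_inter_preimage_eq_mul.1 h.indep) S.toLeft
    (sets := fun i => sets (Sum.inl i)) hL
  have e2 := (iIndepFun_iff_measure_inter_preimage_eq_mul.1 h.poisson.gap_indep) S.toRight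
    (sets := fun i => sets (Sum.inr i)) hR
  have hm1 : MeasurableSet {y : ℕ → ℝ | ∀ i ∈ S.toLeft, y i ∈ sets (Sum.inl i)} := by
    have : {y : ℕ → ℝ | ∀ i ∈ S.toLeft, y i ∈ sets (Sum.inl i)} =
        ⋂ i ∈ S.toLeft, (fun y => y i) ⁻¹' sets (Sum.inl i) := by ext; simp
    rw [this]
    exact Finset.measurableSet_biInter _ fun i hi => measurable_pi_apply i (hL i hi)
  have hm2 : MeasurableSet {y : ℕ → ℝ | ∀ i ∈ S.toRight, y (i + 1) - y i ∈ sets (Sum.inr i)} := by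
    have : {y : ℕ → ℝ | ∀ i ∈ S.toRight, y (i + 1) - y i ∈ sets (Sum.inr i)} =
        ⋂ i ∈ S.toRight, (fun y => y (i + 1) - y i) ⁻¹' sets (Sum.inr i) := by ext; simp
    rw [this]
    exact Finset.measurableSet_biInter _ fun i hi =>
      ((measurable_pi_apply (i + 1)).sub (measurable_pi_apply i)) (hR i hi)
  have e3 := h.indep_poisson.measure_inter_preimage_eq_mul _ _ hm1 hm2
  have s1 : (fun ω k => Y k ω) ⁻¹' {y : ℕ → ℝ | ∀ i ∈ S.toLeft, y i ∈ sets (Sum.inl i)} =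
      ⋂ i ∈ S.toLeft, Y i ⁻¹' sets (Sum.inl i) := by ext; simp
  have s2 : (fun ω k => t k ω) ⁻¹'
      {y : ℕ → ℝ | ∀ i ∈ S.toRight, y (i + 1) - y i ∈ sets (Sum.inr i)} =
      ⋂ i ∈ S.toRight, (fun ω => t (i + 1) ω - t i ω) ⁻¹' sets (Sum.inr i) := by ext; simp
  have s3 : ⋂ i ∈ S, inputFamily t Y i ⁻¹' sets i =
      (⋂ i ∈ S.toLeft, Y i ⁻¹' sets (Sum.inl i)) ∩
      ⋂ i ∈ S.toRight, (fun ω => t (i + 1) ω - t i ω) ⁻¹' sets (Sum.inr i) := by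
    ext ω; simp [inputFamily]
  rw [s1, s2, e1, e2] at e3
  rw [s3, e3]
  conv_rhs => rw [← Finset.toLeft_disjSum_toRight (u := S), Finset.prod_disjSum]
  rfl

lemma IsClusterInput.indep_past (h : IsClusterInput t Y P) (k : ℕ) :
    Indep (pastSigma t Y k)
      (MeasurableSpace.comap (fun ω => (Y k ω, t (k + 1) ω - t k ω)) inferInstance) P := by
  have h1 := indep_iSup_of_disjoint (fun i => (h.measurable_inputFamily i).comap_le)
    h.iIndepFun_inputFamily.iIndep
    (S := {i : ℕ ⊕ ℕ | Sum.elim id id i < k}) (T := {i : ℕ ⊕ ℕ | Sum.elim id id i = k})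
    (Set.disjoint_left.2 fun i hi hi' => (ne_of_lt hi) hi')
  refine indep_of_indep_of_le_right h1 ?_
  have hle : ∀ i, Sum.elim id id i = k → Measurable[⨆ i ∈ {i : ℕ ⊕ ℕ | Sum.elim id id i = k},
      MeasurableSpace.comap (inputFamily t Y i) inferInstance] (inputFamily t Y i) := fun i hi =>
    measurable_iff_comap_le.2
      (le_iSup₂_of_le (f := fun i (_ : i ∈ {i : ℕ ⊕ ℕ | Sum.elim id id i = k}) =>
        MeasurableSpace.comap (inputFamily t Y i) inferInstance) i hi le_rfl)
  exact measurable_iff_comap_le.1 ((hle (Sum.inl k) rfl).prodMk (hle (Sum.inr k) rfl))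

variable [IsProbabilityMeasure P]

lemma IsClusterInput.map_step (h : IsClusterInput t Y P) (k : ℕ) :
    P.map (fun ω => (Y k ω, t (k + 1) ω - t k ω)) = (expMeasure 1).prod (expMeasure 1) := by
  have hi : IndepFun (Y k) (fun ω => t (k + 1) ω - t k ω) P :=
    h.iIndepFun_inputFamily.indepFun (i := Sum.inl k) (j := Sum.inr k) (by simp)
  have hm : Measurable fun ω => t (k + 1) ω - t k ω := h.measurable_inputFamily (Sum.inr k)
  rw [(indepFun_iff_map_prod_eq_prod_map_map (h.measurable k).aemeasurable hm.aemeasurable).1 hi,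
    (h.law k).map_eq,
    (h.poisson.gap_law k).map_eq]

/-- The Markov property: the variables of step `k` can be integrated out. -/
lemma IsClusterInput.lintegral_alive (h : IsClusterInput t Y P) (k : ℕ)
    {F : (ℝ × ℝ) × (ℝ × ℝ) → ℝ≥0∞} (hF : Measurable F) :
    ∫⁻ ω in aliveSet t Y k,
      F ((clusterZ t Y k ω, t k ω), (Y k ω, t (k + 1) ω - t k ω)) ∂P =
    ∫⁻ ω in aliveSet t Y k, ∫⁻ p, F ((clusterZ t Y k ω, t k ω), p)
      ∂((expMeasure 1).prod (expMeasure 1)) ∂P := by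
  have : IsProbabilityMeasure (expMeasure 1) := isProbabilityMeasure_expMeasure one_pos
  have hYm : ∀ j < k, Measurable[pastSigma t Y k] (Y j) := fun j hj =>
    measurable_past_inputFamily t Y (i := Sum.inl j) hj
  have htm : ∀ j ≤ k, Measurable[pastSigma t Y k] (t j) :=
    @measurable_points Ω (pastSigma t Y k) t h.poisson.zero k fun j hj =>
      measurable_past_inputFamily t Y (i := Sum.inr j) hj
  have hZm := @measurable_clusterZ Ω (pastSigma t Y k) t Y k htm hYm k le_rfl
  have hAm := @measurableSet_aliveSet Ω (pastSigma t Y k) t Y k htm hYm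
  set A : Ω → ℝ≥0∞ := (aliveSet t Y k).indicator fun _ => 1
  set X : Ω → ℝ≥0∞ × (ℝ × ℝ) := fun ω => (A ω, (clusterZ t Y k ω, t k ω))
  set W : Ω → ℝ × ℝ := fun ω => (Y k ω, t (k + 1) ω - t k ω)
  have hXp : Measurable[pastSigma t Y k] X :=
    (measurable_const.indicator hAm).prodMk (hZm.prodMk (htm k le_rfl))
  have hle : pastSigma t Y k ≤ ‹MeasurableSpace Ω› :=
    iSup₂_le fun i _ => (h.measurable_inputFamily i).comap_le
  have hX : Measurable X := hXp.mono hle le_rfl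
  have hA' : MeasurableSet (aliveSet t Y k) := hle _ hAm
  have hW : Measurable W :=
    (h.measurable k).prodMk (h.measurable_inputFamily (Sum.inr k))
  have hind : IndepFun X W P := by
    rw [IndepFun_iff_Indep]
    exact indep_of_indep_of_le_left (h.indep_past k) (measurable_iff_comap_le.1 hXp)
  have hmap := (indepFun_iff_map_prod_eq_prod_map_map hX.aemeasurable hW.aemeasurable).1 hind
  set H : (ℝ≥0∞ × (ℝ × ℝ)) × (ℝ × ℝ) → ℝ≥0∞ := fun q => q.1.1 * F (q.1.2, q.2) with hH
  have hHm : Measurable H := by fun_prop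
  have l1 : ∫⁻ ω in aliveSet t Y k, F ((clusterZ t Y k ω, t k ω), W ω) ∂P =
      ∫⁻ ω, H (X ω, W ω) ∂P := by
    rw [← lintegral_indicator hA']
    refine lintegral_congr fun ω => ?_
    by_cases hω : ω ∈ aliveSet t Y k <;> simp [H, X, A, hω]
  have l2 : ∫⁻ ω in aliveSet t Y k, ∫⁻ p, F ((clusterZ t Y k ω, t k ω), p)
      ∂((expMeasure 1).prod (expMeasure 1)) ∂P =
      ∫⁻ ω, ∫⁻ p, H (X ω, p) ∂((expMeasure 1).prod (expMeasure 1)) ∂P := by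
    rw [← lintegral_indicator hA']
    refine lintegral_congr fun ω => ?_
    by_cases hω : ω ∈ aliveSet t Y k <;> simp [H, X, A, hω]
  rw [l1, l2, ← lintegral_map (f := H) hHm (hX.prodMk hW), hmap, lintegral_prod _ hHm.aemeasurable,
    h.map_step k, lintegral_map (hHm.lintegral_prod_right') hX]

end Cluster

/-! ### The law of the cluster -/

section Cluster

variable {Ω : Type*} [MeasurableSpace Ω] {P : Measure Ω} {t Y : ℕ → Ω → ℝ}

lemma IsClusterInput.ae_nonneg (h : IsClusterInput t Y P) : ∀ᵐ ω ∂P, ∀ k, 0 ≤ Y k ω := by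
  rw [ae_all_iff]
  intro k
  have h1 : ∀ᵐ y ∂(expMeasure 1), 0 ≤ y := by
    have h2 : (expMeasure 1) (Iio 0) = 0 := by
      rw [← lintegral_indicator_one measurableSet_Iio,
        lintegral_expMeasure _ (measurable_one.indicator measurableSet_Iio),
        setLIntegral_congr_fun (g := fun _ => 0) measurableSet_Ioi fun y hy => ?_]
      · simp
      · have : y ∉ Iio (0:ℝ) := by simpa using (le_of_lt hy : (0:ℝ) ≤ y)
        simp [indicator_of_notMem this]
    rw [ae_iff]
    simpa only [not_le] using! h2
  rw [← (h.law k).map_eq] at h1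
  exact ae_of_ae_map (h.measurable k).aemeasurable h1

lemma one_le_clusterZ {Ω : Type*} (t : ℕ → Ω → ℝ) {Y : ℕ → Ω → ℝ} {ω : Ω}
    (hY : ∀ k, 0 ≤ Y k ω) (k : ℕ) : 1 ≤ clusterZ t Y k ω := by
  induction k with
  | zero => exact le_rfl
  | succ k ih =>
    have := mul_nonneg (hY k) (Real.exp_pos (t k ω)).le
    change 1 ≤ clusterZ t Y k ω + Y k ω * Real.exp (t k ω)
    linarith

/-- The chain `z k * e ^ (-t k)`; the cluster ends when it falls below `1`. -/
noncomputable def clusterChain {Ω : Type*} (t Y : ℕ → Ω → ℝ) (k : ℕ) (ω : Ω) : ℝ :=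
  clusterZ t Y k ω * Real.exp (-t k ω)

lemma one_le_clusterChain_iff {Ω : Type*} {t Y : ℕ → Ω → ℝ} {ω : Ω} (hY : ∀ k, 0 ≤ Y k ω) (k : ℕ) :
    1 ≤ clusterChain t Y k ω ↔ t k ω ≤ Real.log (clusterZ t Y k ω) := by
  have hz : 0 < clusterZ t Y k ω := by linarith [one_le_clusterZ t hY k]
  rw [Real.le_log_iff_exp_le hz, clusterChain, Real.exp_neg, ← div_eq_mul_inv,
    one_le_div (Real.exp_pos _)]

lemma mem_aliveSet_succ {Ω : Type*} {t Y : ℕ → Ω → ℝ} {ω : Ω} (hY : ∀ k, 0 ≤ Y k ω) {k : ℕ}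
    (hk : ω ∈ aliveSet t Y k) : ω ∈ aliveSet t Y (k + 1) ↔ 1 ≤ clusterChain t Y (k + 1) ω := by
  rw [one_le_clusterChain_iff hY]
  refine ⟨fun h => h (k + 1) le_rfl, fun h j hj => ?_⟩
  rcases Nat.le_succ_iff.1 hj with hj | rfl
  · exact hk j hj
  · exact h

lemma IsClusterInput.measurable_clusterZ (h : IsClusterInput t Y P) (k : ℕ) :
    Measurable (clusterZ t Y k) :=
  _root_.measurable_clusterZ (fun j _ => h.poisson.measurable j) (fun j _ => h.measurable j)
    k le_rfl

lemma IsClusterInput.measurableSet_aliveSet (h : IsClusterInput t Y P) (k : ℕ) :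
    MeasurableSet (aliveSet t Y k) :=
  _root_.measurableSet_aliveSet (fun j _ => h.poisson.measurable j) (fun j _ => h.measurable j)

lemma aliveSet_succ_subset {Ω : Type*} (t Y : ℕ → Ω → ℝ) (k : ℕ) :
    aliveSet t Y (k + 1) ⊆ aliveSet t Y k := fun _ hω j hj => hω j (by omega)

lemma aliveSet_zero {Ω : Type*} {t Y : ℕ → Ω → ℝ} (h0 : ∀ ω, t 0 ω = 0) :
    aliveSet t Y 0 = univ := by
  ext ω; simp [aliveSet, h0, clusterZ]

lemma IsClusterInput.ae_alive (h : IsClusterInput t Y P) (k : ℕ) :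
    ∀ᵐ ω ∂P.restrict (aliveSet t Y k), (∀ k, 0 ≤ Y k ω) ∧ ω ∈ aliveSet t Y k ∧
      1 ≤ clusterChain t Y k ω := by
  filter_upwards [ae_restrict_mem (h.measurableSet_aliveSet k),
    ae_restrict_of_ae h.ae_nonneg] with ω h1 h2
  exact ⟨h2, h1, (one_le_clusterChain_iff h2 k).2 (h1 k le_rfl)⟩

lemma IsClusterInput.measurable_exitTerm (h : IsClusterInput t Y P) (l m : ℝ) (k : ℕ) :
    Measurable ((aliveSet t Y k \ aliveSet t Y (k + 1)).indicator
      (fun ω => ENNReal.ofReal (Real.exp l ^ (k + 1) * clusterZ t Y (k + 1) ω ^ m))) :=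
  ((((h.measurable_clusterZ (k + 1)).pow_const m).const_mul _).ennreal_ofReal).indicator
    ((h.measurableSet_aliveSet k).diff (h.measurableSet_aliveSet (k + 1)))

variable [IsProbabilityMeasure P]

/-- Integrating out one step of the chain. -/
lemma IsClusterInput.lintegral_succ (h : IsClusterInput t Y P) {s : ℝ} (hs : 0 < s) (μ : ℝ) (k : ℕ)
    {g : ℝ → ℝ≥0∞} (hg : Measurable g) :
    ∫⁻ ω in aliveSet t Y k, ENNReal.ofReal (s ^ (k + 1) * Real.exp (μ * t (k + 1) ω)) *
      g (clusterChain t Y (k + 1) ω) ∂P =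
    ∫⁻ ω in aliveSet t Y k, ENNReal.ofReal (s ^ k * Real.exp (μ * t k ω)) *
      (ENNReal.ofReal s * ∫⁻ p, ENNReal.ofReal (Real.exp (μ * p.2)) *
        g ((clusterChain t Y k ω + p.1) * Real.exp (-p.2))
        ∂((expMeasure 1).prod (expMeasure 1))) ∂P := by
  set F : (ℝ × ℝ) × (ℝ × ℝ) → ℝ≥0∞ := fun q =>
    ENNReal.ofReal (s ^ (k + 1) * Real.exp (μ * (q.1.2 + q.2.2))) *
      g ((q.1.1 + q.2.1 * Real.exp q.1.2) * Real.exp (-(q.1.2 + q.2.2))) with hF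
  have hFm : Measurable F := by fun_prop
  have key := h.lintegral_alive k hFm
  have e1 : ∀ ω, F ((clusterZ t Y k ω, t k ω), (Y k ω, t (k + 1) ω - t k ω)) =
      ENNReal.ofReal (s ^ (k + 1) * Real.exp (μ * t (k + 1) ω)) *
      g (clusterChain t Y (k + 1) ω) := by
    intro ω
    simp only [hF, add_sub_cancel, clusterChain, clusterZ]
  simp only [e1] at key
  rw [key]
  refine lintegral_congr fun ω => ?_
  rw [← mul_assoc, ← ENNReal.ofReal_mul (by positivity),
    ← lintegral_const_mul' _ _ ENNReal.ofReal_ne_top]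
  refine lintegral_congr fun p => ?_
  simp only [hF]
  rw [← mul_assoc, ← ENNReal.ofReal_mul (by positivity)]
  congr 2
  · rw [mul_add, Real.exp_add]; ring
  · rw [clusterChain, neg_add, Real.exp_add]
    have : Real.exp (t k ω) * Real.exp (-t k ω) = 1 := by rw [← Real.exp_add]; simp
    linear_combination (p.1 * Real.exp (-p.2)) * this

lemma IsClusterInput.lintegral_alive_succ (h : IsClusterInput t Y P) {s : ℝ} (hs : 0 < s) (μ : ℝ)
    (k : ℕ) {f : ℝ → ℝ≥0∞} (hf : Measurable f) :
    ∫⁻ ω in aliveSet t Y (k + 1), ENNReal.ofReal (s ^ (k + 1) * Real.exp (μ * t (k + 1) ω)) *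
      f (clusterChain t Y (k + 1) ω) ∂P =
    ∫⁻ ω in aliveSet t Y k, ENNReal.ofReal (s ^ k * Real.exp (μ * t k ω)) *
      stepOp s μ f (clusterChain t Y k ω) ∂P := by
  have h1 := h.lintegral_succ hs μ k (hf.indicator (measurableSet_Ici (a := 1)))
  have h2 : ∫⁻ ω in aliveSet t Y (k + 1),
      ENNReal.ofReal (s ^ (k + 1) * Real.exp (μ * t (k + 1) ω)) *
        f (clusterChain t Y (k + 1) ω) ∂P =
      ∫⁻ ω in aliveSet t Y k, ENNReal.ofReal (s ^ (k + 1) * Real.exp (μ * t (k + 1) ω)) *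
        (Ici 1).indicator f (clusterChain t Y (k + 1) ω) ∂P := by
    rw [← inter_eq_left.2 (aliveSet_succ_subset t Y k),
      ← setLIntegral_indicator (h.measurableSet_aliveSet (k + 1))]
    refine lintegral_congr_ae ((h.ae_alive k).mono fun ω hω => ?_)
    by_cases hω' : ω ∈ aliveSet t Y (k + 1)
    · have := (mem_aliveSet_succ hω.1 hω.2.1).1 hω'
      simp only [indicator_of_mem hω',
        indicator_of_mem (show clusterChain t Y (k + 1) ω ∈ Ici 1 from this)]
    · have := mt (mem_aliveSet_succ hω.1 hω.2.1).2 hω'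
      simp only [indicator_of_notMem hω',
        indicator_of_notMem (show clusterChain t Y (k + 1) ω ∉ Ici 1 from this), mul_zero]
  rw [h2, h1]
  refine lintegral_congr_ae ((h.ae_alive k).mono fun ω hω => ?_)
  simp only
  rw [lintegral_step_alive hs.le μ hω.2.2 hf]

lemma IsClusterInput.lintegral_alive_eq (h : IsClusterInput t Y P) {s : ℝ} (hs : 0 < s) (μ : ℝ)
    (k : ℕ) {f : ℝ → ℝ≥0∞} (hf : Measurable f) :
    ∫⁻ ω in aliveSet t Y k, ENNReal.ofReal (s ^ k * Real.exp (μ * t k ω)) *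
      f (clusterChain t Y k ω) ∂P = (stepOp s μ)^[k] f 1 := by
  induction k generalizing f with
  | zero => simp [aliveSet_zero h.poisson.zero, h.poisson.zero, clusterChain, clusterZ]
  | succ k ih =>
    rw [h.lintegral_alive_succ hs μ k hf, ih (measurable_stepOp s μ f), Function.iterate_succ_apply]

/-- The contribution of the clusters of size `k + 1`. As `e ^ (μ t) x ^ μ = z ^ μ`, the weights of
the chain combine to a power of `z`. -/
lemma IsClusterInput.lintegral_exit (h : IsClusterInput t Y P) {s : ℝ} (hs : 0 < s) (μ : ℝ)
    (k : ℕ) :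
    ∫⁻ ω in aliveSet t Y k \ aliveSet t Y (k + 1),
      ENNReal.ofReal (s ^ (k + 1) * clusterZ t Y (k + 1) ω ^ μ) ∂P =
      (stepOp s μ)^[k] (exitFn s μ) 1 := by
  have h1 := h.lintegral_succ hs μ k (g := (Iio 1).indicator fun v => ENNReal.ofReal (v ^ μ))
    ((by fun_prop : Measurable fun v : ℝ => ENNReal.ofReal (v ^ μ)).indicator measurableSet_Iio)
  have h2 : ∫⁻ ω in aliveSet t Y k \ aliveSet t Y (k + 1),
      ENNReal.ofReal (s ^ (k + 1) * clusterZ t Y (k + 1) ω ^ μ) ∂P =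
      ∫⁻ ω in aliveSet t Y k, ENNReal.ofReal (s ^ (k + 1) * Real.exp (μ * t (k + 1) ω)) *
        (Iio 1).indicator (fun v => ENNReal.ofReal (v ^ μ)) (clusterChain t Y (k + 1) ω) ∂P := by
    rw [sdiff_eq, inter_comm, ← setLIntegral_indicator (h.measurableSet_aliveSet (k + 1)).compl]
    refine lintegral_congr_ae ((h.ae_alive k).mono fun ω hω => ?_)
    by_cases hω' : ω ∈ aliveSet t Y (k + 1)
    · have := (mem_aliveSet_succ hω.1 hω.2.1).1 hω'
      simp only [indicator_of_notMem (show ω ∉ (aliveSet t Y (k + 1))ᶜ from fun h => h hω'),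
        indicator_of_notMem (show clusterChain t Y (k + 1) ω ∉ Iio 1 from not_lt.2 this), mul_zero]
    · have := mt (mem_aliveSet_succ hω.1 hω.2.1).2 hω'
      have hz : 0 < clusterZ t Y (k + 1) ω := by linarith [one_le_clusterZ t hω.1 (k + 1)]
      simp only [indicator_of_mem (show ω ∈ (aliveSet t Y (k + 1))ᶜ from hω'),
        indicator_of_mem (show clusterChain t Y (k + 1) ω ∈ Iio 1 from not_le.1 this)]
      rw [← ENNReal.ofReal_mul (by positivity), clusterChain,
        Real.mul_rpow hz.le (Real.exp_pos _).le, ← Real.exp_mul]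
      have : Real.exp (μ * t (k + 1) ω) * Real.exp (-t (k + 1) ω * μ) = 1 := by
        rw [← Real.exp_add]; ring_nf; simp
      congr 1
      linear_combination (-(s ^ (k + 1) * clusterZ t Y (k + 1) ω ^ μ)) * this
  rw [h2, h1, ← h.lintegral_alive_eq hs μ k (measurable_exitFn s μ)]
  refine lintegral_congr_ae ((h.ae_alive k).mono fun ω hω => ?_)
  simp only
  rw [lintegral_step_exit hs.le μ hω.2.2]

lemma IsClusterInput.tsum_measure_aliveSet (h : IsClusterInput t Y P) :
    ∑' k, P (aliveSet t Y k) = 2 := by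
  rw [← greenPotential_one, greenPotential]
  congr 1
  ext k
  rw [← h.lintegral_alive_eq one_pos 0 k measurable_const]
  simp

lemma IsClusterInput.ae_exists (h : IsClusterInput t Y P) :
    ∀ᵐ ω ∂P, ∃ n : ℕ, Real.log (clusterZ t Y n ω) < t n ω := by
  have hne : ∑' k, P (aliveSet t Y k) ≠ ⊤ := by rw [h.tsum_measure_aliveSet]; simp
  filter_upwards [ae_eventually_notMem hne] with ω hω
  obtain ⟨k, hk⟩ := hω.exists
  simp only [aliveSet, mem_ofPred_eq, not_forall, not_le] at hk
  obtain ⟨n, _, hn⟩ := hk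
  exact ⟨n, hn⟩

lemma mem_aliveSet_iff {Ω : Type*} {t Y : ℕ → Ω → ℝ} {ω : Ω}
    (hω : ∃ n : ℕ, Real.log (clusterZ t Y n ω) < t n ω) (k : ℕ) :
    ω ∈ aliveSet t Y k ↔ k < clusterN t Y ω := by
  have hmem : Real.log (clusterZ t Y (clusterN t Y ω) ω) < t (clusterN t Y ω) ω := Nat.sInf_mem hω
  constructor
  · intro hk
    by_contra hlt
    exact absurd hmem (not_lt.2 (hk _ (not_lt.1 hlt)))
  · intro hk j hj
    exact not_lt.1 (Nat.notMem_of_lt_sInf (lt_of_le_of_lt hj hk) :)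

lemma IsClusterInput.ae_clusterN_eq (h : IsClusterInput t Y P) :
    ∀ᵐ ω ∂P, (clusterN t Y ω : ℝ≥0∞) = ∑' k, (aliveSet t Y k).indicator (fun _ => 1) ω := by
  filter_upwards [h.ae_exists] with ω hω
  have h1 : ∀ k, (aliveSet t Y k).indicator (fun _ => (1 : ℝ≥0∞)) ω =
      if k < clusterN t Y ω then 1 else 0 := fun k => by
    have := mem_aliveSet_iff hω k
    by_cases hk : k < clusterN t Y ω
    · rw [if_pos hk, indicator_of_mem (this.2 hk)]
    · rw [if_neg hk, indicator_of_notMem (mt this.1 hk)]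
  simp only [h1]
  rw [tsum_eq_sum (s := Finset.range (clusterN t Y ω)) fun k hk => by
    simpa using hk, Finset.sum_congr rfl fun k hk => if_pos (Finset.mem_range.1 hk)]
  simp

/-- Decomposition of the exponential functional according to the cluster size. -/
lemma IsClusterInput.ae_exp_eq (h : IsClusterInput t Y P) (l m : ℝ) :
    ∀ᵐ ω ∂P, ENNReal.ofReal (Real.exp (l * (clusterN t Y ω : ℝ) + m * clusterF t Y ω)) =
      ∑' k, (aliveSet t Y k \ aliveSet t Y (k + 1)).indicator
        (fun ω => ENNReal.ofReal (Real.exp l ^ (k + 1) * clusterZ t Y (k + 1) ω ^ m)) ω := by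
  filter_upwards [h.ae_exists, h.ae_nonneg] with ω hω hY
  have hmem : ∀ k, ω ∈ aliveSet t Y k \ aliveSet t Y (k + 1) ↔ k + 1 = clusterN t Y ω := fun k => by
    rw [Set.mem_sdiff, mem_aliveSet_iff hω, mem_aliveSet_iff hω]; omega
  have h0 : 0 < clusterN t Y ω := by
    rw [← mem_aliveSet_iff hω, aliveSet_zero h.poisson.zero]; trivial
  obtain ⟨n, hn⟩ : ∃ n, clusterN t Y ω = n + 1 := ⟨clusterN t Y ω - 1, by omega⟩
  have hz : 0 < clusterZ t Y (n + 1) ω := by linarith [one_le_clusterZ t hY (n + 1)]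
  rw [tsum_eq_single n fun k hk => indicator_of_notMem (fun hk' => hk (by
    have := (hmem k).1 hk'; omega)) _, indicator_of_mem ((hmem n).2 hn.symm), clusterF, hn,
    Real.exp_add, Real.rpow_def_of_pos hz, ← Real.exp_nat_mul]
  congr 3 <;> ring

/-- The moment generating function, as an extended nonnegative number, is a Green potential. -/
lemma IsClusterInput.lintegral_exp (h : IsClusterInput t Y P) (l m : ℝ) :
    ∫⁻ ω, ENNReal.ofReal (Real.exp (l * (clusterN t Y ω : ℝ) + m * clusterF t Y ω)) ∂P =
      greenPotential (Real.exp l) m (exitFn (Real.exp l) m) 1 := by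
  rw [lintegral_congr_ae (h.ae_exp_eq l m),
    lintegral_tsum fun k => (h.measurable_exitTerm l m k).aemeasurable, greenPotential]
  congr 1
  ext k
  rw [lintegral_indicator ((h.measurableSet_aliveSet k).diff (h.measurableSet_aliveSet (k + 1))),
    h.lintegral_exit (Real.exp_pos l)]

/-- Measurability is read off the decomposition `IsClusterInput.ae_exp_eq`. -/
lemma IsClusterInput.aestronglyMeasurable_exp (h : IsClusterInput t Y P) (l m : ℝ) :
    AEStronglyMeasurable
      (fun ω => Real.exp (l * (clusterN t Y ω : ℝ) + m * clusterF t Y ω)) P := by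
  have hm : Measurable fun ω => (∑' k, (aliveSet t Y k \ aliveSet t Y (k + 1)).indicator
      (fun ω => ENNReal.ofReal (Real.exp l ^ (k + 1) * clusterZ t Y (k + 1) ω ^ m)) ω).toReal :=
    (Measurable.tsum fun k => h.measurable_exitTerm l m k).ennreal_toReal
  refine AEStronglyMeasurable.congr hm.aestronglyMeasurable ?_
  filter_upwards [h.ae_exp_eq l m] with ω hω
  rw [← hω, ENNReal.toReal_ofReal (Real.exp_pos _).le]

lemma IsClusterInput.mem_mgfDomain_iff (h : IsClusterInput t Y P) (l m : ℝ) :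
    (l, m) ∈ mgfDomain t Y P ↔ greenPotential (Real.exp l) m (exitFn (Real.exp l) m) 1 ≠ ⊤ := by
  rw [← h.lintegral_exp l m, lintegral_ofReal_ne_top_iff_integrable (h.aestronglyMeasurable_exp l m)
    (Eventually.of_forall fun ω => (Real.exp_pos _).le)]
  rfl

lemma IsClusterInput.formula (h : IsClusterInput t Y P) {l m : ℝ}
    (hlm : (l, m) ∈ mgfDomain t Y P) :
    tricomiPsi (-Real.exp l) m 1 ≠ 0 ∧
      ∫ ω, Real.exp (l * (clusterN t Y ω : ℝ) + m * clusterF t Y ω) ∂P =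
        Real.exp l *
          (tricomiPsi (1 - Real.exp l) (1 + m) 1 / tricomiPsi (-Real.exp l) m 1) := by
  have hfin := (h.mem_mgfDomain_iff l m).1 hlm
  refine ⟨(tricomiPsi_pos_of_greenPotential (Real.exp_pos l) hfin le_rfl).ne', ?_⟩
  obtain ⟨h1, h2⟩ := greenPotential_exitFn (Real.exp_pos l) hfin
  rw [integral_eq_lintegral_of_nonneg_ae (Eventually.of_forall fun ω => (Real.exp_pos _).le)
    (h.aestronglyMeasurable_exp l m), h.lintegral_exp l m, h1, ENNReal.toReal_ofReal h2]

/-- Since the cluster size and the log-endpoint are nonnegative, the domain of the moment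
generating function is a lower set. -/
lemma IsClusterInput.mgfDomain_lower (h : IsClusterInput t Y P) {l m l' m' : ℝ}
    (hlm : (l, m) ∈ mgfDomain t Y P) (hl : l' ≤ l) (hm : m' ≤ m) : (l', m') ∈ mgfDomain t Y P := by
  refine Integrable.mono' hlm (h.aestronglyMeasurable_exp l' m') ?_
  filter_upwards [h.ae_nonneg] with ω hY
  have hF : 0 ≤ clusterF t Y ω := Real.log_nonneg (one_le_clusterZ t hY _)
  rw [Real.norm_of_nonneg (Real.exp_pos _).le]
  gcongr

lemma IsClusterInput.convex_mgfDomain (h : IsClusterInput t Y P) :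
    Convex ℝ (mgfDomain t Y P) := by
  rintro ⟨l, m⟩ h1 ⟨l', m'⟩ h2 a b ha hb hab
  refine Integrable.mono' ((h1.const_mul a).add (h2.const_mul b))
    (h.aestronglyMeasurable_exp _ _) (Eventually.of_forall fun ω => ?_)
  rw [Real.norm_of_nonneg (Real.exp_pos _).le]
  have := convexOn_exp.2 (mem_univ (l * (clusterN t Y ω : ℝ) + m * clusterF t Y ω))
    (mem_univ (l' * (clusterN t Y ω : ℝ) + m' * clusterF t Y ω)) ha hb hab
  simp only [smul_eq_mul, Pi.add_apply] at this ⊢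
  refine le_trans (le_of_eq ?_) this
  simp only [Prod.fst_add, Prod.snd_add, Prod.smul_fst, Prod.smul_snd, smul_eq_mul]
  congr 1; ring

/-- Openness. By convexity and because the domain is a lower set, it is enough to find near a
point of the domain one with a larger first coordinate, and anywhere one with a larger second
coordinate. -/
lemma IsClusterInput.isOpen_mgfDomain (h : IsClusterInput t Y P) :
    IsOpen (mgfDomain t Y P) := by
  rw [isOpen_iff_mem_nhds]
  rintro ⟨l, m⟩ hlm
  obtain ⟨s, hs, hfin⟩ := exists_greenPotential_ne_top_of_lt (Real.exp_pos l)
    ((h.mem_mgfDomain_iff l m).1 hlm)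
  have hs0 : 0 < s := (Real.exp_pos l).trans hs
  obtain ⟨r, hr, hfin'⟩ := exists_greenPotential_ne_top (m + 1)
  rw [← Real.exp_log hs0, ← h.mem_mgfDomain_iff] at hfin
  rw [← Real.exp_log hr, ← h.mem_mgfDomain_iff] at hfin'
  have hl : l < Real.log s := (Real.lt_log_iff_exp_lt hs0).2 hs
  -- a point of the segment that lies strictly above and to the right of `(l, m)`
  obtain ⟨θ, hθ0, hθ1, hθ⟩ : ∃ θ : ℝ, 0 < θ ∧ θ < 1 ∧
      l < (1 - θ) * Real.log s + θ * Real.log r := by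
    have hlim : Tendsto (fun θ : ℝ => (1 - θ) * Real.log s + θ * Real.log r) (𝓝[>] 0)
        (𝓝 (Real.log s)) := by
      have : Tendsto (fun θ : ℝ => (1 - θ) * Real.log s + θ * Real.log r) (𝓝 0)
          (𝓝 ((1 - 0) * Real.log s + 0 * Real.log r)) :=
        Continuous.tendsto (by fun_prop) 0
      simpa using this.mono_left nhdsWithin_le_nhds
    obtain ⟨θ, h1, h2⟩ := ((hlim.eventually (lt_mem_nhds hl)).and
      (Ioo_mem_nhdsGT (zero_lt_one (α := ℝ)))).exists
    exact ⟨θ, h2.1, h2.2, h1⟩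
  have hmem := h.convex_mgfDomain hfin hfin' (by linarith : 0 ≤ 1 - θ) hθ0.le (by ring)
  simp only [Prod.smul_mk, smul_eq_mul, Prod.mk_add_mk] at hmem
  have hnhds : Iio ((1 - θ) * Real.log s + θ * Real.log r) ×ˢ
      Iio ((1 - θ) * m + θ * (m + 1)) ∈ 𝓝 (l, m) :=
    prod_mem_nhds (Iio_mem_nhds hθ) (Iio_mem_nhds (by nlinarith))
  refine mem_of_superset hnhds ?_
  rintro ⟨l', m'⟩ ⟨h1, h2⟩
  exact h.mgfDomain_lower hmem (le_of_lt h1) (le_of_lt h2)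

lemma zero_mem_mgfDomain (t Y : ℕ → Ω → ℝ) : ((0 : ℝ), (0 : ℝ)) ∈ mgfDomain t Y P := by
  simp [mgfDomain]

lemma IsClusterInput.integrable_clusterN (h : IsClusterInput t Y P) :
    Integrable (fun ω => (clusterN t Y ω : ℝ)) P ∧ ∫ ω, (clusterN t Y ω : ℝ) ∂P = 2 := by
  have hmeas : ∀ k, Measurable ((aliveSet t Y k).indicator (fun _ => (1 : ℝ≥0∞))) := fun k =>
    measurable_const.indicator (h.measurableSet_aliveSet k)
  have hm : AEStronglyMeasurable (fun ω => (clusterN t Y ω : ℝ)) P := by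
    have hm : Measurable fun ω =>
        (∑' k, (aliveSet t Y k).indicator (fun _ => (1 : ℝ≥0∞)) ω).toReal :=
      (Measurable.tsum hmeas).ennreal_toReal
    refine AEStronglyMeasurable.congr hm.aestronglyMeasurable ?_
    filter_upwards [h.ae_clusterN_eq] with ω hω
    rw [← hω]; simp
  have hl : ∫⁻ ω, ENNReal.ofReal (clusterN t Y ω : ℝ) ∂P = 2 := by
    simp only [ENNReal.ofReal_natCast]
    rw [lintegral_congr_ae h.ae_clusterN_eq, lintegral_tsum fun k => (hmeas k).aemeasurable,
      ← h.tsum_measure_aliveSet]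
    congr 1
    ext k
    exact lintegral_indicator_one (h.measurableSet_aliveSet k)
  have h0 : 0 ≤ᵐ[P] fun ω => (clusterN t Y ω : ℝ) := Eventually.of_forall fun ω => by
    simp only [Pi.zero_apply]; positivity
  refine ⟨(lintegral_ofReal_ne_top_iff_integrable hm h0).1 (by rw [hl]; simp), ?_⟩
  rw [integral_eq_lintegral_of_nonneg_ae h0 hm, hl]
  simp

end Cluster

theorem theorem3 {Ω : Type*} [MeasurableSpace Ω] (P : Measure Ω) [IsProbabilityMeasure P]
    (t Y : ℕ → Ω → ℝ) (h : IsClusterInput t Y P) :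
    -- the cluster size is almost surely finite
    (∀ᵐ ω ∂P, ∃ n : ℕ, Real.log (clusterZ t Y n ω) < t n ω) ∧
    -- the formula holds wherever the moment generating function is finite
    (∀ l m : ℝ, (l, m) ∈ mgfDomain t Y P →
      tricomiPsi (-Real.exp l) m 1 ≠ 0 ∧
      ∫ ω, Real.exp (l * (clusterN t Y ω : ℝ) + m * clusterF t Y ω) ∂P =
        Real.exp l *
          (tricomiPsi (1 - Real.exp l) (1 + m) 1 / tricomiPsi (-Real.exp l) m 1)) ∧
    -- the domain of finiteness
    IsOpen (mgfDomain t Y P) ∧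
    Convex ℝ (mgfDomain t Y P) ∧
    ((0 : ℝ), (0 : ℝ)) ∈ mgfDomain t Y P ∧
    -- the Laplace transform
    (∀ l m : ℝ, 0 ≤ l → 0 ≤ m →
      Integrable (fun ω => Real.exp (-l * (clusterN t Y ω : ℝ) - m * clusterF t Y ω)) P ∧
      tricomiPsi (-Real.exp (-l)) (-m) 1 ≠ 0 ∧
      ∫ ω, Real.exp (-l * (clusterN t Y ω : ℝ) - m * clusterF t Y ω) ∂P =
        Real.exp (-l) *
          (tricomiPsi (1 - Real.exp (-l)) (1 - m) 1 / tricomiPsi (-Real.exp (-l)) (-m) 1)) ∧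
    -- the mean cluster size
    Integrable (fun ω => (clusterN t Y ω : ℝ)) P ∧
    ∫ ω, (clusterN t Y ω : ℝ) ∂P = 2 := by
  refine ⟨h.ae_exists, fun l m hlm => h.formula hlm, h.isOpen_mgfDomain, h.convex_mgfDomain,
    zero_mem_mgfDomain t Y, fun l m hl hm => ?_, h.integrable_clusterN⟩
  have hmem : (-l, -m) ∈ mgfDomain t Y P :=
    h.mgfDomain_lower (zero_mem_mgfDomain t Y) (by linarith) (by linarith)
  have e : ∀ ω, -l * (clusterN t Y ω : ℝ) - m * clusterF t Y ω =
      -l * (clusterN t Y ω : ℝ) + -m * clusterF t Y ω := fun ω => by ring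
  simp only [e, sub_eq_add_neg (1 : ℝ) m]
  exact ⟨hmem, h.formula hmem⟩
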